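/- Fix a positive integer $k$. For a positive integer $\ell$ let $\mathcal A(\ell)$ be the space of weight-$k$ holomorphic cusp forms on $\Gamma_0(\ell)$, a finite-dimensional complex vector space. Fix $V>0$ and equip $\mathcal A(\ell)$ with the Petersson inner product $\langle f,g\rangle_\ell=\int_{\Gamma_0(\ell)\backslash\mathbb H}\overline{f(z)}\,g(z)\,y^k\,d\mu_\ell(z)$, where $\mu_\ell$ is the multiple of the hyperbolic measure $dx\,dy/y^2$ for which $\Gamma_0(\ell)\backslash\mathbb H$ has total volume $V$ (the same $V$ for all $\ell$; for instance $V=1$). For a positive integer $d$ put $\varphi|_d(z):=d^{k/2}\varphi(dz)$. The oldspace of level $q$ is the span in $\mathcal A(q)$ of the forms $\varphi|_d$ with $\varphi\in\mathcal A(\ell)$, $\ell\mid q$, $\ell\neq q$, $d\mid q/\ell$, and the newspace $\mathcal A^*(q)$ is its orthogonal complement in $\mathcal A(q)$. Let $q$ be a positive integer such that $p^3\mid q$ for every prime $p\mid q$. Let $\mathcal B^*(q)$ be an arbitrary orthonormal basis of $\mathcal A^*(q)$ and, for each $\ell\mid q$, let $\mathcal B(\ell)$ be an arbitrary orthonormal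 basis of $\mathcal A(\ell)$. These bases are finite, and for all $z_1,z_2$ in the upper half-plane $$\sum_{\varphi\in\mathcal B^*(q)}\varphi(z_1)\overline{\varphi(z_2)}=\sum_{d,e\mid q}\mu(d)\mu(e)\sum_{\varphi\in\mathcal B(q/(de))}\varphi|_d(z_1)\,\overline{\varphi|_d(z_2)},$$ where $\mu$ is the Möbius function and the terms with $\mu(d)\mu(e)=0$ are read as zero (for $d,e$ squarefree one has $de\mid q$). Equivalently, let $E_{d..de}$, for squarefree $d,e\mid q$, denote the orthogonal projector of $\mathcal A(q)$ onto the subspace $\{\varphi|_d:\varphi\in\mathcal A(q/(de))\}$. These projectors exist, and $\sum_{d,e\mid q}\mu(d)\mu(e)E_{d..de}$ is the orthogonal projector of $\mathcal A(q)$ onto $\mathcal A^*(q)$. -/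

import Mathlib

open UpperHalfPlane MeasureTheory CongruenceSubgroup
open scoped MatrixGroups Modular ComplexConjugate

noncomputable section

namespace NewformKernel

/-- The space of holomorphic cusp forms of weight `k` on `Γ₀(ℓ)`. -/
abbrev A (k ℓ : ℕ) : Type :=
  CuspForm ((Gamma0 ℓ).map (Matrix.SpecialLinearGroup.mapGL ℝ)) (k : ℤ)

/-- A fundamental domain for `Γ₀(ℓ)` acting on `ℍ`: the union of the translates `g⁻¹ 𝒟` of the
standard fundamental domain `𝒟` of `SL(2, ℤ)`, where `g` runs over representatives of the cosets
`g Γ₀(ℓ)` in `SL(2, ℤ)`. -/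
def fundDomain (ℓ : ℕ) : Set ℍ :=
  ⋃ c : SL(2, ℤ) ⧸ Gamma0 ℓ, {τ : ℍ | c.out • τ ∈ 𝒟}

/-- The Petersson inner product on level `ℓ`, conjugate-linear in the first variable, with respect
to the multiple of the hyperbolic measure `dx dy / y ^ 2` (which is `volume` on `ℍ`) that gives
`Γ₀(ℓ) \ ℍ` total volume `V`. -/
def inner (V : ℝ) {k ℓ : ℕ} (f g : A k ℓ) : ℂ :=
  (V : ℂ) * ⨍ τ in fundDomain ℓ, petersson (k : ℤ) f g τ

/-- `φ|_d (z) = d ^ (k / 2) φ(d z)`. -/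
def raise {k ℓ : ℕ} (d : ℕ) (φ : A k ℓ) : ℍ → ℂ := fun z ↦
  (((d : ℝ) ^ ((k : ℝ) / 2) : ℝ) : ℂ) * φ (ofComplex ((d : ℂ) * (z : ℂ)))

/-- The forms `φ|_d` of level `q`, with `φ` a cusp form of level `ℓ`. -/
def raised (k q ℓ d : ℕ) : Set (A k q) :=
  {f | ∃ φ : A k ℓ, (f : ℍ → ℂ) = raise d φ}

/-- The oldspace: the span of all `φ|_d` with `φ` of level `ℓ`, where `ℓ` runs over the proper
divisors of `q` and `d` over the divisors of `q / ℓ`. -/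
def oldspace (k q : ℕ) : Submodule ℂ (A k q) :=
  Submodule.span ℂ {f | ∃ ℓ d : ℕ, ℓ ∣ q ∧ ℓ ≠ q ∧ d ∣ q / ℓ ∧ f ∈ raised k q ℓ d}

/-- The newspace: the orthogonal complement of the oldspace. -/
def newspace (V : ℝ) (k q : ℕ) : Set (A k q) :=
  {f | ∀ g ∈ oldspace k q, inner V g f = 0}

/-- `B` is an orthonormal basis of the subspace `W`. -/
def IsOrthonormalBasis (V : ℝ) {k ℓ : ℕ} (B W : Set (A k ℓ)) : Prop :=
  (∀ φ ∈ B, inner V φ φ = 1) ∧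
  (∀ φ ∈ B, ∀ ψ ∈ B, φ ≠ ψ → inner V φ ψ = 0) ∧
  (Submodule.span ℂ B : Set (A k ℓ)) = W

/-- `E` is the orthogonal projector onto the subspace `W`. -/
def IsOrthogonalProjector (V : ℝ) {k ℓ : ℕ} (E : A k ℓ →ₗ[ℂ] A k ℓ) (W : Set (A k ℓ)) : Prop :=
  ∀ f : A k ℓ, E f ∈ W ∧ ∀ w ∈ W, inner V w (f - E f) = 0

end NewformKernel

end

/-!
Write `E d e` for the projector onto the forms `φ|_d` with `φ` of level `q / (d * e)`. These
projectors behave multiplicatively: for a prime `p ∣ q` one has `E p 1 ∘ E d e = E (d * p) e` if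
`p ∤ d`, and `E 1 p ∘ E d e = E d (e * p)` if `p ∤ e`. Indeed, if `f` is raised by `d` from level
`p * ℓ` with `p ∣ ℓ` (this is where `p ^ 3 ∣ q` enters), the mean of `f` over the translations by
`b / p`, `b` modulo `p`, is raised by `d * p` from level `ℓ`, while forms raised by `p` are
invariant under these translations; so the mean and `f` have the same inner products with them. The
second rule is the same with lower unipotent matrices. Since `μ (d * p) = -μ d`, the Möbius sum of
the `E d e` is annihilated by every `E p 1` and every `E 1 p`; as the oldspace is the span of their
ranges and `E 1 1 = 1`, the sum is the projector onto the newspace.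

For the kernels, evaluation at `z₂` is the inner product with some form `κ`, and
`∑ φ z₁ * conj (φ z₂)` over any orthonormal basis of a subspace is the projection of `κ` to that
subspace evaluated at `z₁`. As `φ ↦ φ|_d` is an isometry, an orthonormal basis of level
`q / (d * e)` is carried to one of the range of `E d e`.
-/

noncomputable section

namespace NewformKernel

open Matrix.GeneralLinearGroup (upperRightHom)
open Matrix.SpecialLinearGroup (mapGL)

section MoebiusProjections

open ArithmeticFunction (moebius)
open scoped InnerProductSpace

theorem squarefree_mul_prime {d p : ℕ} (hd : Squarefree d) (hp : p.Prime) (hpd : ¬p ∣ d) :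
    Squarefree (d * p) :=
  (Nat.squarefree_mul (hp.coprime_iff_not_dvd.2 hpd).symm).2 ⟨hd, hp.prime.squarefree⟩

theorem mul_prime_dvd {d p q : ℕ} (hdq : d ∣ q) (hp : p.Prime) (hpq : p ∣ q) (hpd : ¬p ∣ d) :
    d * p ∣ q :=
  (hp.coprime_iff_not_dvd.2 hpd).symm.mul_dvd_of_dvd_of_dvd hdq hpq

theorem exists_eq_mul_prime_of_squarefree {d : ℕ} (hd : Squarefree d) (hd1 : d ≠ 1) :
    ∃ a p, d = a * p ∧ p.Prime ∧ ¬p ∣ a ∧ Squarefree a := by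
  obtain ⟨p, hp, a, rfl⟩ := Nat.exists_prime_and_dvd hd1
  exact ⟨a, p, mul_comm _ _, hp, hp.coprime_iff_not_dvd.1 (Nat.coprime_of_squarefree_mul hd),
    hd.of_mul_right⟩

theorem sum_moebius_smul_eq_zero {M : Type*} [AddCommGroup M] {q p : ℕ} (hq : q ≠ 0)
    (hp : p.Prime) (hpq : p ∣ q) {G : ℕ → M}
    (hG : ∀ d, d ∣ q → Squarefree d → ¬p ∣ d → G (d * p) = G d) :
    ∑ d ∈ q.divisors, moebius d • G d = 0 := by
  have hsquarefree : ∑ d ∈ q.divisors with Squarefree d, moebius d • G d =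
      ∑ d ∈ q.divisors, moebius d • G d :=
    Finset.sum_filter_of_ne fun d _ hd ↦ by
      contrapose! hd
      rw [ArithmeticFunction.moebius_eq_zero_of_not_squarefree hd, zero_smul]
  rw [← hsquarefree, ← Finset.sum_filter_not_add_sum_filter _ (p ∣ ·), ← eq_neg_iff_add_eq_zero,
    ← Finset.sum_neg_distrib]
  refine Finset.sum_bij (fun d _ ↦ d * p) (fun d hd ↦ ?_)
    (fun _ _ _ _ h ↦ Nat.eq_of_mul_eq_mul_right hp.pos h) (fun b hb ↦ ?_) (fun d hd ↦ ?_)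
  · simp only [Finset.mem_filter, Nat.mem_divisors] at hd ⊢
    obtain ⟨⟨⟨hdq, -⟩, hds⟩, hpd⟩ := hd
    exact ⟨⟨⟨mul_prime_dvd hdq hp hpq hpd, hq⟩, squarefree_mul_prime hds hp hpd⟩, dvd_mul_left _ _⟩
  · simp only [Finset.mem_filter, Nat.mem_divisors] at hb
    obtain ⟨⟨⟨hbq, -⟩, hbs⟩, c, rfl⟩ := hb
    refine ⟨c, ?_, mul_comm _ _⟩
    simp only [Finset.mem_filter, Nat.mem_divisors]
    exact ⟨⟨⟨(dvd_mul_left _ _).trans hbq, hq⟩, hbs.of_mul_right⟩,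
      hp.coprime_iff_not_dvd.1 (Nat.coprime_of_squarefree_mul hbs)⟩
  · simp only [Finset.mem_filter, Nat.mem_divisors] at hd
    obtain ⟨⟨⟨hdq, -⟩, hds⟩, hpd⟩ := hd
    rw [hG d hdq hds hpd, ArithmeticFunction.isMultiplicative_moebius.map_mul_of_coprime
      (hp.coprime_iff_not_dvd.2 hpd).symm, ArithmeticFunction.moebius_apply_prime hp, mul_neg_one,
      neg_zsmul, neg_neg]

variable {𝕜 H : Type*} [RCLike 𝕜] [NormedAddCommGroup H] [InnerProductSpace 𝕜 H]

theorem starProjection_comp_starProjection_eq {U V X : Submodule 𝕜 H}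
    [U.HasOrthogonalProjection] [V.HasOrthogonalProjection] [X.HasOrthogonalProjection]
    (hXU : X ≤ U) (hXV : X ≤ V) (h : ∀ v ∈ V, ∃ x ∈ X, ∀ u ∈ U, ⟪u, x⟫_𝕜 = ⟪u, v⟫_𝕜) :
    U.starProjection ∘L V.starProjection = X.starProjection := by
  ext f
  obtain ⟨x, hx, hinner⟩ := h _ (V.starProjection_apply_mem f)
  have hU : V.starProjection f - x ∈ Uᗮ := fun u hu ↦ by
    rw [inner_sub_right, hinner u hu, sub_self]
  have hX : f - x ∈ Xᗮ := by
    rw [← sub_add_sub_cancel f (V.starProjection f) x]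
    exact add_mem (Submodule.orthogonal_le hXV (V.sub_starProjection_mem_orthogonal f))
      (Submodule.orthogonal_le hXU hU)
  exact (U.eq_starProjection_of_mem_orthogonal (hXU hx) hU).trans
    (X.eq_starProjection_of_mem_orthogonal hx hX).symm

/-- A family of subspaces `W d e`, for squarefree divisors `d`, `e` of `q`, in which projecting to
`W p 1` after `W d e`, with `p` a prime not dividing `d`, lands in `W (d * p) e`. It encodes one of
the two symmetric rules satisfied by the spaces of forms `φ|_d` with `φ` of level `q / (d * e)`. -/
def IsMulProjectionFamily (q : ℕ) (W : ℕ → ℕ → Submodule 𝕜 H)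
    [∀ d e, (W d e).HasOrthogonalProjection] : Prop :=
  ∀ p d e : ℕ, p.Prime → p ∣ q → d ∣ q → e ∣ q → Squarefree d → Squarefree e → ¬p ∣ d →
    (W p 1).starProjection ∘L (W d e).starProjection = (W (d * p) e).starProjection

variable {q : ℕ} {W : ℕ → ℕ → Submodule 𝕜 H} [∀ d e, (W d e).HasOrthogonalProjection]

namespace IsMulProjectionFamily

theorem starProjection_sum_eq_zero (hW : IsMulProjectionFamily q W) (hq : q ≠ 0) {p : ℕ}
    (hp : p.Prime) (hpq : p ∣ q) (f : H) :
    (W p 1).starProjection (∑ d ∈ q.divisors, ∑ e ∈ q.divisors,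
      (moebius d * moebius e) • (W d e).starProjection f) = 0 := by
  rw [Finset.sum_comm, map_sum]
  refine Finset.sum_eq_zero fun e he ↦ ?_
  by_cases hes : Squarefree e
  · simp only [mul_comm (moebius _) (moebius e), mul_smul, ← Finset.smul_sum, map_zsmul, map_sum]
    rw [sum_moebius_smul_eq_zero hq hp hpq, smul_zero]
    intro d hdq hds hpd
    rw [← hW p d e hp hpq hdq (Nat.dvd_of_mem_divisors he) hds hes hpd]
    exact Submodule.starProjection_eq_self_iff.2 (Submodule.starProjection_apply_mem _ _)
  · simp [ArithmeticFunction.moebius_eq_zero_of_not_squarefree hes]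

theorem exists_prime_le (hW : IsMulProjectionFamily q W) {d e : ℕ} (hdq : d ∣ q) (heq : e ∣ q)
    (hd : Squarefree d) (he : Squarefree e) (hd1 : d ≠ 1) :
    ∃ p, p.Prime ∧ p ∣ q ∧ W d e ≤ W p 1 := by
  obtain ⟨a, p, rfl, hp, hpa, ha⟩ := exists_eq_mul_prime_of_squarefree hd hd1
  have hpq : p ∣ q := (dvd_mul_left p a).trans hdq
  refine ⟨p, hp, hpq, fun f hf ↦ ?_⟩
  rw [← Submodule.starProjection_eq_self_iff.2 hf,
    ← hW p a e hp hpq ((dvd_mul_right a p).trans hdq) heq ha he hpa]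
  exact Submodule.starProjection_apply_mem _ _

end IsMulProjectionFamily

theorem le_iSup_sup_of_ne_one (hleft : IsMulProjectionFamily q W)
    (hright : IsMulProjectionFamily q fun e d ↦ W d e) {d e : ℕ} (hdq : d ∣ q) (heq : e ∣ q)
    (hd : Squarefree d) (he : Squarefree e) (hne : ¬(d = 1 ∧ e = 1)) :
    W d e ≤ ⨆ p : {p : ℕ // p.Prime ∧ p ∣ q}, W p 1 ⊔ W 1 p := by
  by_cases hd1 : d = 1
  · obtain ⟨p, hp, hpq, hle⟩ := hright.exists_prime_le heq hdq he hd fun he1 ↦ hne ⟨hd1, he1⟩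
    exact le_iSup_of_le ⟨p, hp, hpq⟩ (hle.trans le_sup_right)
  · obtain ⟨p, hp, hpq, hle⟩ := hleft.exists_prime_le hdq heq hd he hd1
    exact le_iSup_of_le ⟨p, hp, hpq⟩ (hle.trans le_sup_left)

theorem sub_sum_moebius_starProjection_mem (hq : q ≠ 0) (hone : W 1 1 = ⊤)
    (hleft : IsMulProjectionFamily q W) (hright : IsMulProjectionFamily q fun e d ↦ W d e) (f : H) :
    f - ∑ d ∈ q.divisors, ∑ e ∈ q.divisors, (moebius d * moebius e) • (W d e).starProjection f ∈
      ⨆ p : {p : ℕ // p.Prime ∧ p ∣ q}, W p 1 ⊔ W 1 p := by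
  have hfst : (W 1 1).starProjection f = f := by
    rw [Submodule.starProjection_eq_self_iff, hone]
    exact Submodule.mem_top
  rw [← Finset.sum_product', ← Finset.add_sum_erase _ _ (a := (1, 1)) (by simp [hq])]
  simp only [ArithmeticFunction.moebius_apply_one, mul_one, one_smul, hfst, sub_add_cancel_left]
  refine neg_mem (sum_mem fun ⟨d, e⟩ hde ↦ ?_)
  obtain ⟨hne, hmem⟩ := Finset.mem_erase.1 hde
  obtain ⟨hd, he⟩ := Finset.mem_product.1 hmem
  by_cases hs : Squarefree d ∧ Squarefree e
  · exact zsmul_mem (le_iSup_sup_of_ne_one hleft hright (Nat.dvd_of_mem_divisors hd)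
      (Nat.dvd_of_mem_divisors he) hs.1 hs.2 (by simpa using hne)
      (Submodule.starProjection_apply_mem _ _)) _
  · rw [not_and_or] at hs
    rcases hs with hs | hs <;> simp [ArithmeticFunction.moebius_eq_zero_of_not_squarefree hs]

theorem sum_moebius_starProjection_eq [CompleteSpace H] (hq : q ≠ 0) (hone : W 1 1 = ⊤)
    (hleft : IsMulProjectionFamily q W) (hright : IsMulProjectionFamily q fun e d ↦ W d e) (f : H) :
    ∑ d ∈ q.divisors, ∑ e ∈ q.divisors, (moebius d * moebius e) • (W d e).starProjection f =
      (⨆ p : {p : ℕ // p.Prime ∧ p ∣ q}, W p 1 ⊔ W 1 p)ᗮ.starProjection f := by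
  refine (Submodule.eq_starProjection_of_mem_orthogonal ?_ (Submodule.le_orthogonal_orthogonal _
    (sub_sum_moebius_starProjection_mem hq hone hleft hright f))).symm
  simp only [← Submodule.iInf_orthogonal, ← Submodule.inf_orthogonal, Submodule.mem_iInf,
    Submodule.mem_inf]
  intro ⟨p, hp, hpq⟩
  refine ⟨(Submodule.starProjection_apply_eq_zero_iff _).1
    (hleft.starProjection_sum_eq_zero hq hp hpq f), ?_⟩
  rw [Finset.sum_comm, ← Submodule.starProjection_apply_eq_zero_iff]
  simpa only [mul_comm] using hright.starProjection_sum_eq_zero hq hp hpq f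

end MoebiusProjections

section Kernel

open scoped InnerProductSpace

variable {𝕜 H : Type*} [RCLike 𝕜] [NormedAddCommGroup H] [InnerProductSpace 𝕜 H]

theorem starProjection_span_eq_sum {s : Finset H} (hs : Orthonormal 𝕜 ((↑) : s → H))
    [(Submodule.span 𝕜 (s : Set H)).HasOrthogonalProjection] (f : H) :
    (Submodule.span 𝕜 (s : Set H)).starProjection f = ∑ φ ∈ s, ⟪φ, f⟫_𝕜 • φ := by
  refine Submodule.eq_starProjection_of_mem_orthogonal ?_ ?_
  · exact sum_mem fun φ hφ ↦ Submodule.smul_mem _ _ (Submodule.subset_span hφ)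
  · rw [Submodule.mem_orthogonal]
    suffices Submodule.span 𝕜 (s : Set H) ≤ (𝕜 ∙ (f - ∑ φ ∈ s, ⟪φ, f⟫_𝕜 • φ))ᗮ from
      fun u hu ↦ Submodule.mem_orthogonal_singleton_iff_inner_left.1 (this hu)
    refine Submodule.span_le.2 fun ψ hψ ↦ Submodule.mem_orthogonal_singleton_iff_inner_left.2 ?_
    rw [inner_sub_right, ← Finset.sum_coe_sort s fun φ ↦ ⟪φ, f⟫_𝕜 • φ, hs.inner_right_fintype
      (fun φ : s ↦ ⟪(φ : H), f⟫_𝕜) ⟨ψ, hψ⟩, sub_self]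

theorem finsum_mul_conj_eq_apply_starProjection [CompleteSpace H] {B : Set H} (hfin : B.Finite)
    (hB : Orthonormal 𝕜 ((↑) : B → H)) [(Submodule.span 𝕜 B).HasOrthogonalProjection]
    (L M : StrongDual 𝕜 H) :
    ∑ᶠ φ ∈ B, L φ * conj (M φ) =
      L ((Submodule.span 𝕜 B).starProjection ((InnerProductSpace.toDual 𝕜 H).symm M)) := by
  lift B to Finset H using hfin
  rw [starProjection_span_eq_sum hB, map_sum, finsum_mem_coe_finset]
  refine Finset.sum_congr rfl fun φ _ ↦ ?_
  rw [map_smul, ← inner_conj_symm, InnerProductSpace.toDual_symm_apply, smul_eq_mul, mul_comm]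

end Kernel

section FundamentalDomain

open scoped Pointwise

theorem pairwise_aedisjoint_inv_smul {ι G α : Type*} [Group G] [MulAction G α]
    [MeasurableSpace α] {μ : Measure α} {s : Set α} (hs : IsFundamentalDomain G s μ) {r : ι → G}
    (hr : Function.Injective r) :
    Pairwise (Function.onFun (AEDisjoint μ) fun i ↦ (r i)⁻¹ • s) :=
  fun _ _ hij ↦ hs.aedisjoint fun h ↦ hij (hr (inv_injective h))

variable {M α : Type*} [Group M] [MulAction M α] [MeasurableSpace α] {μ : Measure α}
  [MeasurableConstSMul M α] [SMulInvariantMeasure M α μ] {G H : Subgroup M} {s t : Set α}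

theorem isFundamentalDomain_conj_smul (hs : IsFundamentalDomain H s μ) (g : M) :
    IsFundamentalDomain (MulAut.conj g • H : Subgroup M) (g • s) μ := by
  refine hs.image_of_equiv (MulAction.toPerm g)
    (measurePreserving_smul g⁻¹ μ).quasiMeasurePreserving
    (Subgroup.equivSMul (MulAut.conj g) H).symm.toEquiv fun h x ↦ ?_
  obtain ⟨h, rfl⟩ := (Subgroup.equivSMul (MulAut.conj g) H).surjective h
  simp only [MulEquiv.toEquiv_eq_coe, MulEquiv.coe_toEquiv, MulEquiv.symm_apply_apply]
  change g • h.1 • x = (g * h.1 * g⁻¹) • g • x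
  rw [← mul_smul, ← mul_smul, inv_mul_cancel_right]

theorem isFundamentalDomain_iUnion_inv_smul {ι : Type*} [Countable ι] {r : ι → G}
    (hHG : H ≤ G) (hs : IsFundamentalDomain G s μ)
    (hr : Function.Bijective fun i ↦ (r i : G ⧸ H.subgroupOf G)) :
    IsFundamentalDomain H (⋃ i, (r i)⁻¹ • s) μ := by
  refine .mk'' (.iUnion fun i ↦ hs.nullMeasurableSet_smul _) ?_ ?_
    fun h ↦ (measurePreserving_smul h μ).quasiMeasurePreserving
  · filter_upwards [hs.ae_covers] with x ⟨g, hg⟩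
    obtain ⟨i, hi⟩ := hr.2 g
    have hmem : (r i)⁻¹ * g ∈ H.subgroupOf G := QuotientGroup.eq.1 hi
    refine ⟨⟨_, hmem⟩, Set.mem_iUnion.2 ⟨i, ?_⟩⟩
    change ((r i)⁻¹ * g) • x ∈ _
    rwa [mul_smul, Set.smul_mem_smul_set_iff]
  · intro h hh
    simp only [Set.smul_set_iUnion, AEDisjoint.iUnion_left_iff, AEDisjoint.iUnion_right_iff]
    intro j i
    change AEDisjoint μ ((⟨h, hHG h.2⟩ : G) • (r i)⁻¹ • s) _
    rw [← mul_smul]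
    refine hs.aedisjoint fun heq ↦ hh ?_
    have hri : r i = r j * ⟨h, hHG h.2⟩ := by
      rw [← inv_inv (r j), ← heq]
      group
    have hij : i = j := hr.1 (by
      simp only [hri]
      exact QuotientGroup.mk_mul_of_mem _ h.2)
    subst hij
    have hone : (⟨h, hHG h.2⟩ : G) = 1 := mul_eq_left.1 hri.symm
    exact Subtype.ext (Subtype.ext_iff.1 hone :)

theorem bijective_mk_quotient_out (K : Subgroup M) :
    Function.Bijective fun c : M ⧸ K ↦ (c.out : M ⧸ K) := by
  simpa only [QuotientGroup.out_eq'] using! Function.bijective_id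

variable [Countable G]

theorem measure_eq_tsum_quotient (hHG : H ≤ G) (hs : IsFundamentalDomain G s μ)
    (ht : IsFundamentalDomain H t μ) : μ t = ∑' _ : G ⧸ H.subgroupOf G, μ s := by
  have : Countable (G ⧸ H.subgroupOf G) := Quotient.countable
  have : Countable H := (Subgroup.inclusion_injective hHG).countable
  rw [ht.measure_eq (isFundamentalDomain_iUnion_inv_smul hHG hs (bijective_mk_quotient_out _)),
    measure_iUnion₀ (pairwise_aedisjoint_inv_smul hs (r := fun c : G ⧸ H.subgroupOf G ↦ c.out)
        Quotient.out_injective)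
      fun c ↦ hs.nullMeasurableSet_smul _]
  simp only [measure_smul]

theorem isFiniteRelIndex_of_measure_ne_top (hμ : μ ≠ 0) (hHG : H ≤ G)
    (hs : IsFundamentalDomain G s μ) (ht : IsFundamentalDomain H t μ) (htop : μ t ≠ ⊤) :
    H.IsFiniteRelIndex G := by
  rw [measure_eq_tsum_quotient hHG hs ht] at htop
  have : Finite (G ⧸ H.subgroupOf G) := by
    by_contra! hinf
    exact htop (ENNReal.tsum_const_eq_top_of_ne_zero (hs.measure_ne_zero hμ))
  exact ⟨Subgroup.index_ne_zero_of_finite⟩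

theorem measureReal_eq_relIndex_smul [H.IsFiniteRelIndex G] (hHG : H ≤ G)
    (hs : IsFundamentalDomain G s μ) (ht : IsFundamentalDomain H t μ) :
    μ.real t = H.relIndex G • μ.real s := by
  let := Fintype.ofFinite (G ⧸ H.subgroupOf G)
  rw [measureReal_def, measure_eq_tsum_quotient hHG hs ht, tsum_fintype, Finset.sum_const,
    Finset.card_univ, ← Nat.card_eq_fintype_card, ENNReal.toReal_nsmul]
  rfl

theorem setIntegral_eq_relIndex_smul {E : Type*} [NormedAddCommGroup E] [NormedSpace ℝ E]
    [H.IsFiniteRelIndex G] (hHG : H ≤ G) (hs : IsFundamentalDomain G s μ)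
    (ht : IsFundamentalDomain H t μ) {f : α → E}
    (hf : ∀ (g : G) x, f (g • x) = f x) :
    ∫ x in t, f x ∂μ = H.relIndex G • ∫ x in s, f x ∂μ := by
  have : Countable H := (Subgroup.inclusion_injective hHG).countable
  let := Fintype.ofFinite (G ⧸ H.subgroupOf G)
  have hfH (h : H) (x : α) : f (h • x) = f x := hf ⟨h, hHG h.2⟩ x
  have hunion := isFundamentalDomain_iUnion_inv_smul hHG hs (bijective_mk_quotient_out _)
  have hintegrable (g : G) : IntegrableOn f (g • s) μ ↔ IntegrableOn f s μ :=
    (hs.smul g).integrableOn_iff hs hf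
  rw [ht.setIntegral_eq hunion hfH]
  by_cases hfs : IntegrableOn f s μ
  · rw [integral_iUnion_ae (fun c ↦ hs.nullMeasurableSet_smul _)
      (pairwise_aedisjoint_inv_smul hs (r := fun c : G ⧸ H.subgroupOf G ↦ c.out)
        Quotient.out_injective)
      (integrableOn_finite_iUnion.2 fun c ↦ (hintegrable _).2 hfs), tsum_fintype,
      Finset.sum_congr rfl fun c _ ↦ (hs.smul (c.out)⁻¹).setIntegral_eq hs hf, Finset.sum_const,
      Finset.card_univ, ← Nat.card_eq_fintype_card]
    rfl
  · have hnot : ¬IntegrableOn f (⋃ c : G ⧸ H.subgroupOf G, (c.out)⁻¹ • s) μ := fun h ↦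
      hfs ((hintegrable _).1 (integrableOn_finite_iUnion.1 h (1 : G)))
    rw [integral_undef hnot, integral_undef hfs, smul_zero]

theorem setAverage_eq_of_subgroup_le {E : Type*} [NormedAddCommGroup E] [NormedSpace ℝ E]
    (hμ : μ ≠ 0) (hHG : H ≤ G) (hs : IsFundamentalDomain G s μ) (ht : IsFundamentalDomain H t μ)
    (htop : μ t ≠ ⊤) {f : α → E} (hf : ∀ (g : G) x, f (g • x) = f x) :
    ⨍ x in t, f x ∂μ = ⨍ x in s, f x ∂μ := by
  have := isFiniteRelIndex_of_measure_ne_top hμ hHG hs ht htop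
  have hindex : (H.relIndex G : ℝ) ≠ 0 := Nat.cast_ne_zero.2 H.relIndex_ne_zero
  rw [setAverage_eq, setAverage_eq, measureReal_eq_relIndex_smul hHG hs ht,
    setIntegral_eq_relIndex_smul hHG hs ht hf, nsmul_eq_mul, mul_inv_rev,
    ← Nat.cast_smul_eq_nsmul ℝ, smul_smul, inv_mul_cancel_right₀ hindex]

end FundamentalDomain

section Action

open scoped Pointwise

theorem setLIntegral_Ioi_inv_sq_lt_top {c : ℝ} (hc : 0 < c) :
    ∫⁻ y in Set.Ioi c, (((1 / ‖y‖₊) ^ 2 : NNReal) : ENNReal) < ⊤ := by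
  have hintegrable := (integrableOn_Ioi_rpow_of_lt (a := -2) (by norm_num) hc).hasFiniteIntegral
  rw [hasFiniteIntegral_iff_enorm] at hintegrable
  convert hintegrable using 1
  refine setLIntegral_congr_fun measurableSet_Ioi fun y hy ↦ ?_
  have hy' : 0 < y := hc.trans hy
  simp [enorm_eq_nnnorm, Real.rpow_neg hy'.le]

theorem volume_strip_lt_top (a b : ℝ) {c : ℝ} (hc : 0 < c) :
    volume {τ : ℍ | τ.re ∈ Set.Icc a b ∧ c < τ.im} < ⊤ := by
  have hsub : UpperHalfPlane.coe '' {τ : ℍ | τ.re ∈ Set.Icc a b ∧ c < τ.im} ⊆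
      Complex.measurableEquivRealProd ⁻¹' (Set.Icc a b ×ˢ Set.Ioi c) := by
    rintro _ ⟨τ, hτ, rfl⟩
    exact hτ
  have hprod := Complex.volume_preserving_equiv_real_prod.setLIntegral_comp_preimage_emb
    Complex.measurableEquivRealProd.measurableEmbedding
    (fun p : ℝ × ℝ ↦ (((1 / ‖p.2‖₊) ^ 2 : NNReal) : ENNReal)) (Set.Icc a b ×ˢ Set.Ioi c)
  have hsplit := lintegral_prod_mul (μ := (volume : Measure ℝ).restrict (Set.Icc a b))
    (ν := (volume : Measure ℝ).restrict (Set.Ioi c)) (f := fun _ ↦ 1)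
    (g := fun y : ℝ ↦ (((1 / ‖y‖₊) ^ 2 : NNReal) : ENNReal)) (by fun_prop) (by fun_prop)
  simp only [one_mul] at hsplit
  rw [volume_eq_lintegral]
  refine (lintegral_mono_set hsub).trans_lt (hprod.trans_lt ?_)
  rw [Measure.volume_eq_prod, ← Measure.prod_restrict, hsplit]
  exact ENNReal.mul_lt_top (by simp) (setLIntegral_Ioi_inv_sq_lt_top hc)

theorem volume_fd_lt_top : volume 𝒟 < (⊤ : ENNReal) := by
  refine (measure_mono fun τ hτ ↦ ?_).trans_lt
    (volume_strip_lt_top (-(1 / 2)) (1 / 2) (c := 1 / 2) (by norm_num))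
  have him := ModularGroup.three_le_four_mul_im_sq_of_mem_fd hτ
  exact ⟨abs_le.1 hτ.2, by nlinarith [τ.im_pos]⟩

instance : (volume : Measure ℍ).IsOpenPosMeasure where
  open_pos U hU hne hzero := by
    have hopen : IsOpen (UpperHalfPlane.coe '' U) := isOpenEmbedding_coe.isOpenMap U hU
    refine hopen.measure_ne_zero volume (hne.image _) ?_
    rw [volume_eq_lintegral, setLIntegral_eq_zero_iff hopen.measurableSet (by fun_prop)] at hzero
    rw [measure_eq_zero_iff_ae_notMem]
    filter_upwards [hzero] with z hz
    rintro ⟨τ, hτ, rfl⟩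
    have := hz ⟨τ, hτ, rfl⟩
    simp [τ.im_ne_zero] at this

theorem volume_upperHalfPlane_ne_zero : (volume : Measure ℍ) ≠ 0 :=
  have : Nonempty ℍ := ⟨I⟩
  NeZero.ne _

theorem volume_setOf_re_eq (x : ℝ) : volume {z : ℂ | z.re = x} = 0 := by
  have h := Complex.volume_preserving_equiv_real_prod.measure_preimage_emb
    Complex.measurableEquivRealProd.measurableEmbedding ({x} ×ˢ Set.univ)
  rw [Measure.volume_eq_prod, Measure.prod_prod, Real.volume_singleton, zero_mul] at h
  convert h using 2
  ext z
  simp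

theorem image_coe_fd_diff_fdo_subset : UpperHalfPlane.coe '' (𝒟 \ 𝒟ᵒ) ⊆
    Metric.sphere 0 1 ∪ ({z : ℂ | z.re = 1 / 2} ∪ {z : ℂ | z.re = -(1 / 2)}) := by
  rintro _ ⟨τ, ⟨⟨hnorm, hre⟩, hnot⟩, rfl⟩
  rcases hnorm.eq_or_lt with hone | hlt
  · left
    rw [Complex.normSq_eq_norm_sq] at hone
    simpa using (pow_eq_one_iff_of_nonneg (norm_nonneg _) two_ne_zero).1 hone.symm
  · right
    have habs : |τ.re| = 1 / 2 := hre.antisymm (not_lt.1 fun h ↦ hnot ⟨hlt, h⟩)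
    exact (abs_eq (by norm_num)).1 habs

theorem volume_fd_diff_fdo : volume (𝒟 \ 𝒟ᵒ) = 0 := by
  rw [volume_eq_lintegral]
  exact setLIntegral_measure_zero _ _ <| measure_mono_null image_coe_fd_diff_fdo_subset <|
    measure_union_null (Measure.addHaar_sphere _ _ _)
      (measure_union_null (volume_setOf_re_eq _) (volume_setOf_re_eq _))

/-- The group of transformations of `ℍ` induced by `GL(2, ℝ)`. Fundamental domains are taken for
subgroups of it rather than of `SL(2, ℤ)`, in which `-1` acts trivially. -/
abbrev Moeb : Subgroup (Equiv.Perm ℍ) := (MulAction.toPermHom (GL (Fin 2) ℝ) ℍ).range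

/-- The transformation of `ℍ` induced by an invertible matrix. -/
def toMoeb : GL (Fin 2) ℝ →* Moeb := (MulAction.toPermHom (GL (Fin 2) ℝ) ℍ).rangeRestrict

theorem toMoeb_surjective : Function.Surjective toMoeb := MonoidHom.rangeRestrict_surjective _

instance : MeasurableConstSMul Moeb ℍ where
  measurable_const_smul c := by
    obtain ⟨g, rfl⟩ := toMoeb_surjective c
    exact measurable_const_smul g

instance : SMulInvariantMeasure Moeb ℍ volume where
  measure_preimage_smul c s hs := by
    obtain ⟨g, rfl⟩ := toMoeb_surjective c
    exact measure_preimage_smul_of_nullMeasurableSet (μ := volume) hs.nullMeasurableSet g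

theorem toMoeb_mapGL_eq_one_iff {γ : SL(2, ℤ)} : toMoeb (mapGL ℝ γ) = 1 ↔ γ = 1 ∨ γ = -1 := by
  refine ⟨fun h ↦ ?_, ?_⟩
  · have hmem : (⟨2 * Complex.I, by simp⟩ : ℍ) ∈ 𝒟ᵒ := by
      refine ⟨?_, ?_⟩
      · norm_num [Complex.normSq_apply]
      · simp [← coe_re]
    have hfix : γ • (⟨2 * Complex.I, by simp⟩ : ℍ) = ⟨2 * Complex.I, by simp⟩ :=
      congrArg (fun σ : Moeb ↦ σ • (⟨2 * Complex.I, by simp⟩ : ℍ)) h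
    exact ModularGroup.eq_one_or_neg_one_of_mem_fdo_mem_fd hmem
      (hfix.symm ▸ ModularGroup.fdo_subset_fd hmem)
  · rintro (rfl | rfl)
    · simp
    · ext τ
      change (((-1 : SL(2, ℤ)) • τ : ℍ) : ℂ) = τ
      simp

/-- The image of a subgroup of `SL(2, ℤ)` in the group of transformations of `ℍ`. -/
def moeb (Γ : Subgroup SL(2, ℤ)) : Subgroup Moeb := (Γ.map (mapGL ℝ)).map toMoeb

theorem mem_moeb {Γ : Subgroup SL(2, ℤ)} {c : Moeb} :
    c ∈ moeb Γ ↔ ∃ γ ∈ Γ, toMoeb (mapGL ℝ γ) = c := by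
  simp [moeb]

theorem toMoeb_mapGL_mem_moeb {Γ : Subgroup SL(2, ℤ)} (hneg : -1 ∈ Γ) {γ : SL(2, ℤ)} :
    toMoeb (mapGL ℝ γ) ∈ moeb Γ ↔ γ ∈ Γ := by
  refine ⟨fun h ↦ ?_, fun h ↦ mem_moeb.2 ⟨γ, h, rfl⟩⟩
  obtain ⟨δ, hδ, heq⟩ := mem_moeb.1 h
  have hquot : toMoeb (mapGL ℝ (δ⁻¹ * γ)) = 1 := by
    rw [map_mul, map_mul, map_inv, map_inv, heq, inv_mul_cancel]
  refine (Subgroup.mul_mem_cancel_left Γ (inv_mem hδ)).1 ?_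
  rcases toMoeb_mapGL_eq_one_iff.1 hquot with hone | hone
  · exact hone ▸ one_mem Γ
  · exact hone ▸ hneg

instance : Countable SL(2, ℤ) :=
  Subtype.countable (α := Fin 2 → Fin 2 → ℤ)

instance (Γ : Subgroup SL(2, ℤ)) : Countable (moeb Γ) :=
  Function.Surjective.countable
    (f := fun γ : Γ ↦ (⟨toMoeb (mapGL ℝ γ.1), mem_moeb.2 ⟨γ, γ.2, rfl⟩⟩ : moeb Γ)) <| by
    rintro ⟨c, hc⟩
    obtain ⟨γ, hγ, rfl⟩ := mem_moeb.1 hc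
    exact ⟨⟨γ, hγ⟩, rfl⟩

theorem isFundamentalDomain_fd : IsFundamentalDomain (moeb ⊤) 𝒟 := by
  refine .mk'' ModularGroup.isClosed_fd.nullMeasurableSet (.of_forall fun τ ↦ ?_) ?_
    fun c ↦ (measurePreserving_smul c volume).quasiMeasurePreserving
  · obtain ⟨γ, hγ⟩ := ModularGroup.exists_smul_mem_fd τ
    exact ⟨(⟨toMoeb (mapGL ℝ γ), mem_moeb.2 ⟨γ, Subgroup.mem_top γ, rfl⟩⟩ : moeb ⊤), hγ⟩
  · rintro ⟨c, hc⟩ hne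
    obtain ⟨γ, -, rfl⟩ := mem_moeb.1 hc
    refine measure_mono_null (fun τ ⟨hτγ, hτ⟩ ↦ ?_) volume_fd_diff_fdo
    refine Set.mem_sdiff_of_mem hτ fun hmem ↦ hne (Subtype.ext (inv_eq_one.1 ?_))
    have hinv : γ⁻¹ • τ ∈ 𝒟 := by
      have := Set.mem_smul_set_iff_inv_smul_mem.1 hτγ
      rwa [Subgroup.smul_def, Subgroup.coe_inv, ← map_inv, ← map_inv] at this
    rw [← map_inv, ← map_inv]
    exact toMoeb_mapGL_eq_one_iff.2 (ModularGroup.eq_one_or_neg_one_of_mem_fdo_mem_fd hmem hinv)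

/-- The fundamental domain for a subgroup of `SL(2, ℤ)` made of translates of `𝒟`. -/
def fdOf (Γ : Subgroup SL(2, ℤ)) : Set ℍ := ⋃ c : SL(2, ℤ) ⧸ Γ, {τ : ℍ | c.out • τ ∈ 𝒟}

/-- The transformation induced by the chosen representative of a coset in `SL(2, ℤ)`. -/
def cosetMoeb {Γ : Subgroup SL(2, ℤ)} (c : SL(2, ℤ) ⧸ Γ) : moeb ⊤ :=
  ⟨toMoeb (mapGL ℝ c.out), mem_moeb.2 ⟨c.out, Subgroup.mem_top _, rfl⟩⟩

theorem fdOf_eq_iUnion_inv_smul (Γ : Subgroup SL(2, ℤ)) :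
    fdOf Γ = ⋃ c : SL(2, ℤ) ⧸ Γ, (cosetMoeb c)⁻¹ • 𝒟 := by
  ext τ
  simp only [Set.mem_iUnion, Set.mem_inv_smul_set_iff]
  exact Set.mem_iUnion

theorem bijective_mk_cosetMoeb {Γ : Subgroup SL(2, ℤ)} (hneg : -1 ∈ Γ) :
    Function.Bijective fun c : SL(2, ℤ) ⧸ Γ ↦
      (cosetMoeb c : moeb ⊤ ⧸ (moeb Γ).subgroupOf (moeb ⊤)) := by
  have hmk (c : SL(2, ℤ) ⧸ Γ) (γ : SL(2, ℤ)) (hγ : toMoeb (mapGL ℝ γ) ∈ moeb ⊤) :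
      (cosetMoeb c : moeb ⊤ ⧸ (moeb Γ).subgroupOf (moeb ⊤)) =
        ((⟨toMoeb (mapGL ℝ γ), hγ⟩ : moeb ⊤) : moeb ⊤ ⧸ (moeb Γ).subgroupOf (moeb ⊤)) ↔ c = γ := by
    rw [QuotientGroup.eq, Subgroup.mem_subgroupOf, ← QuotientGroup.out_eq' c, QuotientGroup.eq,
      QuotientGroup.out_eq', ← toMoeb_mapGL_mem_moeb hneg]
    simp [cosetMoeb]
  refine ⟨fun c c' h ↦ ?_, fun x ↦ ?_⟩
  · exact ((hmk c c'.out _).1 h).trans (QuotientGroup.out_eq' c')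
  · obtain ⟨⟨σ, hσ⟩, rfl⟩ := QuotientGroup.mk_surjective x
    obtain ⟨γ, -, rfl⟩ := mem_moeb.1 hσ
    exact ⟨γ, (hmk γ γ hσ).2 rfl⟩

theorem isFundamentalDomain_fdOf {Γ : Subgroup SL(2, ℤ)} (hneg : -1 ∈ Γ) :
    IsFundamentalDomain (moeb Γ) (fdOf Γ) := by
  have : Countable (SL(2, ℤ) ⧸ Γ) := Quotient.countable
  rw [fdOf_eq_iUnion_inv_smul]
  exact isFundamentalDomain_iUnion_inv_smul (Subgroup.map_mono (Subgroup.map_mono le_top))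
    isFundamentalDomain_fd (bijective_mk_cosetMoeb hneg)

theorem volume_fdOf_lt_top (Γ : Subgroup SL(2, ℤ)) [Γ.FiniteIndex] : volume (fdOf Γ) < ⊤ := by
  rw [fdOf_eq_iUnion_inv_smul]
  have := Fintype.ofFinite (SL(2, ℤ) ⧸ Γ)
  refine (measure_iUnion_le _).trans_lt ?_
  simp only [measure_smul, tsum_fintype]
  exact ENNReal.sum_lt_top.2 fun _ _ ↦ volume_fd_lt_top

theorem eq_empty_of_isOpen_of_volume_inter_fdOf_eq_zero {Γ : Subgroup SL(2, ℤ)} (hneg : -1 ∈ Γ)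
    {t : Set ℍ} (ht : IsOpen t) (hinv : ∀ γ ∈ Γ, ∀ τ : ℍ, γ • τ ∈ t ↔ τ ∈ t)
    (hzero : volume (t ∩ fdOf Γ) = 0) : t = ∅ := by
  refine (ht.measure_eq_zero_iff volume).1
    ((isFundamentalDomain_fdOf hneg).measure_zero_of_invariant t (fun σ ↦ ?_) hzero)
  rw [← Set.preimage_smul_inv]
  obtain ⟨γ, hγ, hσ⟩ := mem_moeb.1 (inv_mem σ.2)
  ext τ
  change ((σ.1)⁻¹ • τ ∈ t) ↔ _
  rw [← hσ]
  exact hinv γ hγ τ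

theorem setAverage_fdOf_smul {E : Type*} [NormedAddCommGroup E] [NormedSpace ℝ E]
    {Γ₁ Γ₂ : Subgroup SL(2, ℤ)} [Γ₁.FiniteIndex] (hneg₁ : -1 ∈ Γ₁) (hneg₂ : -1 ∈ Γ₂)
    {g : GL (Fin 2) ℝ} (hg : ∀ γ ∈ Γ₁, ∃ δ ∈ Γ₂, mapGL ℝ δ = g * mapGL ℝ γ * g⁻¹) {f : ℍ → E}
    (hf : ∀ γ ∈ Γ₂, ∀ τ : ℍ, f (γ • τ) = f τ) :
    ⨍ τ in fdOf Γ₁, f (g • τ) = ⨍ τ in fdOf Γ₂, f τ := by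
  have hle : MulAut.conj (toMoeb g) • moeb Γ₁ ≤ moeb Γ₂ := by
    rintro _ ⟨σ, hσ, rfl⟩
    obtain ⟨γ, hγ, rfl⟩ := mem_moeb.1 hσ
    obtain ⟨δ, hδ, hconj⟩ := hg γ hγ
    exact mem_moeb.2 ⟨δ, hδ, by simp [hconj]⟩
  have hvol : volume (toMoeb g • fdOf Γ₁) = volume (fdOf Γ₁) :=
    measure_smul volume (toMoeb g) (fdOf Γ₁)
  have hinv (σ : moeb Γ₂) (τ : ℍ) : f (σ • τ) = f τ := by
    obtain ⟨_, hσ⟩ := σ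
    obtain ⟨γ, hγ, rfl⟩ := mem_moeb.1 hσ
    exact hf γ hγ τ
  rw [← setAverage_eq_of_subgroup_le volume_upperHalfPlane_ne_zero hle
    (isFundamentalDomain_fdOf hneg₂)
    (isFundamentalDomain_conj_smul (isFundamentalDomain_fdOf hneg₁) (toMoeb g))
    (hvol.trans_lt (volume_fdOf_lt_top Γ₁)).ne hinv, setAverage_eq, setAverage_eq, measureReal_def,
    measureReal_def, hvol]
  congr 1
  exact ((measurePreserving_smul g volume).setIntegral_image_emb
    (measurableEmbedding_const_smul g) f (fdOf Γ₁)).symm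

end Action

section InnerProduct

variable {k ℓ : ℕ}

theorem neg_one_mem_Gamma0 (ℓ : ℕ) : -1 ∈ Gamma0 ℓ := by
  simp [Gamma0_mem]

theorem volume_fundDomain_lt_top (ℓ : ℕ) [NeZero ℓ] : volume (fundDomain ℓ) < ⊤ :=
  volume_fdOf_lt_top (Gamma0 ℓ)

theorem volume_fundDomain_ne_zero (ℓ : ℕ) : volume (fundDomain ℓ) ≠ 0 :=
  (isFundamentalDomain_fdOf (neg_one_mem_Gamma0 ℓ)).measure_ne_zero volume_upperHalfPlane_ne_zero

theorem petersson_smul_of_mem_Gamma0 (f g : A k ℓ) {γ : SL(2, ℤ)} (hγ : γ ∈ Gamma0 ℓ) (τ : ℍ) :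
    petersson (k : ℤ) f g (γ • τ) = petersson k f g τ :=
  SlashInvariantFormClass.petersson_smul (Subgroup.mem_map_of_mem (mapGL ℝ) hγ)

theorem integrableOn_petersson [NeZero ℓ] (f g : A k ℓ) :
    IntegrableOn (petersson (k : ℤ) f g) (fundDomain ℓ) := by
  obtain ⟨C, hC⟩ := CuspFormClass.petersson_bounded_left k ((Gamma0 ℓ).map (mapGL ℝ)) f g
  exact Measure.integrableOn_of_bounded (M := C) (volume_fundDomain_lt_top ℓ).ne
    (petersson_continuous _ (ModularFormClass.continuous f)
      (ModularFormClass.continuous g)).aestronglyMeasurable (.of_forall hC)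

theorem inner_conj_symm (V : ℝ) (f g : A k ℓ) : conj (inner V g f) = inner V f g := by
  simp only [inner, setAverage_eq, map_mul, Complex.conj_ofReal, Complex.real_smul,
    ← integral_conj, ← petersson_symm]

theorem inner_add_left [NeZero ℓ] (V : ℝ) (f g h : A k ℓ) :
    inner V (f + g) h = inner V f h + inner V g h := by
  have hadd : petersson (k : ℤ) ⇑(f + g) h =
      fun τ ↦ petersson k f h τ + petersson k g h τ := by
    ext τ
    simp only [petersson, FunLike.coe_add, Pi.add_apply, map_add]
    ring
  simp only [inner, setAverage_eq, hadd,
    integral_add (integrableOn_petersson f h) (integrableOn_petersson g h), smul_add, mul_add]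

theorem inner_smul_left (V : ℝ) (f g : A k ℓ) (c : ℂ) :
    inner V (c • f) g = conj c * inner V f g := by
  have hsmul : petersson (k : ℤ) ⇑(c • f) g = fun τ ↦ conj c * petersson k f g τ := by
    ext τ
    simp only [petersson, FunLike.coe_smul, Pi.smul_apply, smul_eq_mul, map_mul]
    ring
  simp only [inner, setAverage_eq, hsmul, integral_const_mul, Complex.real_smul]
  ring

theorem petersson_self (f : ℍ → ℂ) (τ : ℍ) :
    petersson (k : ℤ) f f τ = ((‖f τ‖ ^ 2 * τ.im ^ k : ℝ) : ℂ) := by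
  simp [petersson, Complex.conj_mul']

theorem inner_self (V : ℝ) (f : A k ℓ) :
    inner V f f = ((V * ((volume.real (fundDomain ℓ))⁻¹ *
      ∫ τ in fundDomain ℓ, ‖f τ‖ ^ 2 * τ.im ^ k) : ℝ) : ℂ) := by
  simp only [inner, setAverage_eq, petersson_self, integral_complex_ofReal, Complex.real_smul]
  push_cast
  rfl

theorem eq_zero_of_setIntegral_norm_sq_eq_zero [NeZero ℓ] {f : A k ℓ}
    (h : ∫ τ in fundDomain ℓ, ‖f τ‖ ^ 2 * τ.im ^ k = 0) : f = 0 := by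
  have hself (τ : ℍ) : f τ = 0 ↔ petersson (k : ℤ) f f τ = 0 := by
    simp [petersson_self, τ.im_ne_zero]
  have hintegrable : IntegrableOn (fun τ : ℍ ↦ ‖f τ‖ ^ 2 * τ.im ^ k) (fundDomain ℓ) := by
    simpa only [petersson_self, RCLike.re_eq_complex_re, Complex.ofReal_re] using!
      (integrableOn_petersson f f).re
  rw [integral_eq_zero_iff_of_nonneg
    (fun τ ↦ mul_nonneg (sq_nonneg _) (pow_nonneg τ.im_pos.le _)) hintegrable] at h
  have hempty : {τ | f τ ≠ 0} = ∅ := by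
    refine eq_empty_of_isOpen_of_volume_inter_fdOf_eq_zero (neg_one_mem_Gamma0 ℓ)
      (isOpen_ne_fun (ModularFormClass.continuous f) continuous_const) (fun γ hγ τ ↦ ?_) ?_
    · simp only [Set.mem_ofPred_eq, ne_eq, hself, petersson_smul_of_mem_Gamma0 f f hγ]
    · rw [← Measure.restrict_apply₀'
        (isFundamentalDomain_fdOf (neg_one_mem_Gamma0 ℓ)).nullMeasurableSet,
        measure_eq_zero_iff_ae_notMem]
      filter_upwards [h] with τ hτ hne
      exact hne (by simpa [τ.im_ne_zero] using hτ)
  ext τ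
  exact not_not.1 (Set.eq_empty_iff_forall_notMem.1 hempty τ)

/-- The Petersson inner product as a definite inner product. -/
abbrev innerCore {V : ℝ} (hV : 0 < V) (k ℓ : ℕ) [NeZero ℓ] : InnerProductSpace.Core ℂ (A k ℓ) where
  inner := inner V
  conj_inner_symm f g := inner_conj_symm V f g
  re_inner_nonneg f := by
    have : 0 ≤ ∫ τ in fundDomain ℓ, ‖f τ‖ ^ 2 * τ.im ^ k :=
      integral_nonneg fun τ ↦ mul_nonneg (sq_nonneg _) (pow_nonneg τ.im_pos.le _)
    rw [inner_self, RCLike.re_eq_complex_re, Complex.ofReal_re]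
    positivity
  add_left := inner_add_left V
  smul_left := inner_smul_left V
  definite f h := by
    have hvol : volume.real (fundDomain ℓ) ≠ 0 :=
      ENNReal.toReal_ne_zero.2 ⟨volume_fundDomain_ne_zero ℓ, (volume_fundDomain_lt_top ℓ).ne⟩
    rw [inner_self, Complex.ofReal_eq_zero, mul_eq_zero, mul_eq_zero, or_iff_right hV.ne',
      inv_eq_zero, or_iff_right hvol] at h
    exact eq_zero_of_setIntegral_norm_sq_eq_zero h

end InnerProduct

section FiniteDimension

open Filter Topology Asymptotics Function
open scoped ModularForm

theorem isBigO_pow_of_natCast_le_analyticOrderAt {F : ℂ → ℂ} (hF : AnalyticAt ℂ F 0) {N : ℕ}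
    (h : (N : ℕ∞) ≤ analyticOrderAt F 0) : F =O[𝓝 0] fun z ↦ z ^ N := by
  obtain ⟨g, hg, hFg⟩ := (natCast_le_analyticOrderAt hF).1 h
  have hmul : F =ᶠ[𝓝 0] fun z ↦ z ^ N * g z := by simpa using! hFg
  refine hmul.trans_isBigO ?_
  simpa using (isBigO_refl (fun z : ℂ ↦ z ^ N) _).mul (hg.continuousAt.isBigO_one ℂ)

theorem natCast_le_analyticOrderAt_of_isBigO_pow {F : ℂ → ℂ} (hF : AnalyticAt ℂ F 0) {N : ℕ}
    (h : F =O[𝓝[≠] 0] fun z ↦ z ^ N) : (N : ℕ∞) ≤ analyticOrderAt F 0 := by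
  by_contra! hlt
  obtain ⟨n, hn⟩ := ENat.ne_top_iff_exists.1 hlt.ne_top
  rw [← hn, Nat.cast_lt] at hlt
  obtain ⟨g, hg, hg0, hFg⟩ := hF.analyticOrderAt_eq_natCast.1 hn.symm
  have hone : (fun _ ↦ g 0) =O[𝓝 0] g :=
    ((isEquivalent_const_iff_tendsto hg0).2 hg.continuousAt).isBigO_symm
  have hmul : (fun z ↦ z ^ n * g 0) =O[𝓝 0] F := by
    refine ((isBigO_refl (fun z : ℂ ↦ z ^ n) _).mul hone).trans_eventuallyEq ?_
    filter_upwards [hFg] with z hz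
    simp [hz]
  have hpow : (fun z : ℂ ↦ z ^ n) =O[𝓝 0] F := by
    simpa only [mul_inv_cancel_right₀ hg0, mul_comm (g 0)⁻¹] using hmul.const_mul_left (g 0)⁻¹
  refine isLittleO_irrefl' (Eventually.frequently ?_)
    (((hpow.mono nhdsWithin_le_nhds).trans h).trans_isLittleO
      ((isLittleO_pow_pow hlt).mono nhdsWithin_le_nhds))
  filter_upwards [self_mem_nhdsWithin] with z hz
  exact norm_ne_zero_iff.2 (pow_ne_zero n hz)

theorem isBigO_qParam_pow_iff_natCast_le_analyticOrderAt {F : Type*} [FunLike F ℍ ℂ] {k : ℤ}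
    {Γ : Subgroup (GL (Fin 2) ℝ)} [ModularFormClass F Γ k] (hΓ : 1 ∈ Γ.strictPeriods) (f : F)
    (N : ℕ) : f =O[atImInfty] (fun τ : ℍ ↦ Periodic.qParam 1 τ ^ N) ↔
      (N : ℕ∞) ≤ analyticOrderAt (cuspFunction 1 f) 0 := by
  have han := ModularFormClass.analyticAt_cuspFunction_zero f one_pos hΓ
  refine ⟨fun h ↦ natCast_le_analyticOrderAt_of_isBigO_pow han ?_, fun h ↦ ?_⟩
  · refine (h.comp_tendsto
      (tendsto_comap_im_ofComplex.comp (Periodic.invQParam_tendsto one_pos))).congr' ?_ ?_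
    · filter_upwards [self_mem_nhdsWithin] with q hq
      exact (Periodic.cuspFunction_eq_of_nonzero 1 (f ∘ ofComplex) hq).symm
    · filter_upwards [self_mem_nhdsWithin, (Periodic.invQParam_tendsto one_pos).eventually
        (tendsto_comap.eventually (eventually_gt_atTop 0))] with q hq him
      simp only [comp_apply]
      rw [ofComplex_apply_of_im_pos him, UpperHalfPlane.coe_mk,
        Periodic.qParam_right_inv one_ne_zero hq]
  · exact ((isBigO_pow_of_natCast_le_analyticOrderAt han h).comp_tendsto
      (qParam_tendsto_atImInfty one_pos)).congr_left fun τ ↦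
        SlashInvariantFormClass.eq_cuspFunction f τ hΓ one_ne_zero

theorem qExpansion_coeff_eq_zero_iff_isBigO {F : Type*} [FunLike F ℍ ℂ] {k : ℤ}
    {Γ : Subgroup (GL (Fin 2) ℝ)} [ModularFormClass F Γ k] (hΓ : 1 ∈ Γ.strictPeriods) (f : F)
    (N : ℕ) : (∀ i < N, (qExpansion 1 f).coeff i = 0) ↔
      f =O[atImInfty] fun τ : ℍ ↦ Periodic.qParam 1 τ ^ N := by
  rw [isBigO_qParam_pow_iff_natCast_le_analyticOrderAt hΓ,
    natCast_le_analyticOrderAt_iff_iteratedDeriv_eq_zero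
      (ModularFormClass.analyticAt_cuspFunction_zero f one_pos hΓ)]
  simp [qExpansion_coeff, Nat.factorial_ne_zero]

theorem one_mem_strictPeriods_Gamma0 (ℓ : ℕ) :
    1 ∈ ((Gamma0 ℓ).map (mapGL ℝ)).strictPeriods := by
  rw [strictPeriods_Gamma0]
  exact AddSubgroup.mem_zmultiples 1

section Norm

variable {F : Type*} [FunLike F ℍ ℂ] {k : ℤ} {𝒢 : Subgroup (GL (Fin 2) ℝ)} [𝒢.IsArithmetic]
  [ModularFormClass F 𝒢 k]

theorem quotientFunc_isBigO_one (f : F) (r : 𝒮ℒ ⧸ 𝒢.subgroupOf 𝒮ℒ) :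
    SlashInvariantForm.quotientFunc f r =O[atImInfty] fun _ ↦ (1 : ℂ) := by
  obtain ⟨⟨r, hr⟩, rfl⟩ := QuotientGroup.mk_surjective r
  obtain ⟨γ, hγ⟩ := inv_mem hr
  change ((f : ℍ → ℂ) ∣[k] r⁻¹) =O[atImInfty] _
  rw [← hγ]
  exact (ModularFormClass.bdd_at_infty_slash f γ).trans (isBigO_of_le _ fun _ ↦ by simp)

theorem norm_isBigO_of_isBigO {f : F} {g : ℍ → ℂ} (h : f =O[atImInfty] g) :
    ModularForm.norm 𝒮ℒ f =O[atImInfty] g := by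
  classical
  let := Fintype.ofFinite (𝒮ℒ ⧸ 𝒢.subgroupOf 𝒮ℒ)
  have hone : SlashInvariantForm.quotientFunc f ((1 : 𝒮ℒ) : 𝒮ℒ ⧸ 𝒢.subgroupOf 𝒮ℒ) = f :=
    (SlashInvariantForm.quotientFunc_mk f 1).trans (by simp)
  have hmul := h.mul (IsBigO.finsetProd (s := Finset.univ.erase
    ((1 : 𝒮ℒ) : 𝒮ℒ ⧸ 𝒢.subgroupOf 𝒮ℒ)) fun r _ ↦ quotientFunc_isBigO_one f r)
  simp only [Finset.prod_const_one, mul_one] at hmul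
  refine hmul.congr_left fun τ ↦ ?_
  rw [ModularForm.coe_norm, ← Finset.mul_prod_erase _ _ (Finset.mem_univ ((1 : 𝒮ℒ) :
    𝒮ℒ ⧸ 𝒢.subgroupOf 𝒮ℒ)), hone]
  simp

end Norm

theorem exists_forall_coeff_eq_zero_imp (F : Type*) [FunLike F ℍ ℂ] (k : ℤ)
    {𝒢 : Subgroup (GL (Fin 2) ℝ)} [𝒢.IsArithmetic] [ModularFormClass F 𝒢 k]
    (h𝒢 : 1 ∈ 𝒢.strictPeriods) :
    ∃ N : ℕ, ∀ f : F, (∀ i < N, (qExpansion 1 f).coeff i = 0) → (f : ℍ → ℂ) = 0 := by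
  refine ⟨(k * Nat.card (𝒮ℒ ⧸ 𝒢.subgroupOf 𝒮ℒ)).toNat / 12 + 1, fun f hf ↦ ?_⟩
  rw [qExpansion_coeff_eq_zero_iff_isBigO h𝒢] at hf
  refine (ModularForm.norm_eq_zero_iff 𝒮ℒ f).1 (ModularForm.sturm_bound_levelOne ?_)
  refine (Nat.cast_lt.2 (Nat.lt_succ_self _)).trans_le (PowerSeries.nat_le_order _ _ ?_)
  exact (qExpansion_coeff_eq_zero_iff_isBigO one_mem_strictPeriods_SL _ _).2
    (norm_isBigO_of_isBigO hf)

instance finiteDimensional (k ℓ : ℕ) [NeZero ℓ] : FiniteDimensional ℂ (A k ℓ) := by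
  have hperiod := one_mem_strictPeriods_Gamma0 ℓ
  obtain ⟨N, hN⟩ := exists_forall_coeff_eq_zero_imp (A k ℓ) k hperiod
  let c : A k ℓ →ₗ[ℂ] (Fin N → ℂ) :=
    { toFun f i := (qExpansion 1 f).coeff i
      map_add' f g := by
        ext i
        rw [FunLike.coe_add, ModularForm.qExpansion_add one_pos hperiod f g, map_add,
          Pi.add_apply]
      map_smul' a f := by
        ext i
        rw [FunLike.coe_smul, ModularForm.qExpansion_smul one_pos hperiod a f]
        simp }
  exact FiniteDimensional.of_injective c ((injective_iff_map_eq_zero c).2 fun f hf ↦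
    DFunLike.coe_injective (hN f fun i hi ↦ congrFun hf ⟨i, hi⟩))

end FiniteDimension

section Matrices

open scoped Pointwise

theorem mem_Gamma0_iff_dvd {N : ℕ} {γ : SL(2, ℤ)} : γ ∈ Gamma0 N ↔ (N : ℤ) ∣ γ 1 0 := by
  rw [Gamma0_mem, ZMod.intCast_zmod_eq_zero_iff_dvd]

theorem Gamma0_le_of_dvd {M N : ℕ} (h : M ∣ N) : Gamma0 N ≤ Gamma0 M := fun _ hγ ↦
  mem_Gamma0_iff_dvd.2 ((Int.natCast_dvd_natCast.2 h).trans (mem_Gamma0_iff_dvd.1 hγ))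

section Field

variable (K : Type*) [Field K]

/-- The matrix `diag(d, 1)`, whose slash action is, up to a scalar, the operator `φ ↦ φ|_d`. -/
def diag [CharZero K] (d : ℕ) [NeZero d] : GL (Fin 2) K :=
  .mkOfDetNeZero !![(d : K), 0; 0, 1] (by simp [NeZero.ne d])

variable {K}

/-- The lower triangular unipotent matrix with entry `x`, the transpose of `upperRightHom x`. -/
def lower (x : K) : GL (Fin 2) K := .mkOfDetNeZero !![1, 0; x, 1] (by simp)

@[simp] theorem coe_diag [CharZero K] (d : ℕ) [NeZero d] :
    (diag K d).val = !![(d : K), 0; 0, 1] := rfl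

@[simp] theorem coe_lower (x : K) : (lower x).val = !![1, 0; x, 1] := rfl

theorem lower_add (x y : K) : lower (x + y) = lower x * lower y := by
  ext i j
  fin_cases i <;> fin_cases j <;> simp [Matrix.mul_apply, Fin.sum_univ_two]

theorem diag_mul_upper [CharZero K] (d : ℕ) [NeZero d] (x : K) :
    diag K d * upperRightHom x = upperRightHom (d * x) * diag K d := by
  ext i j
  fin_cases i <;> fin_cases j <;> simp [Matrix.mul_apply, Fin.sum_univ_two]

theorem diag_mul_lower [CharZero K] (d : ℕ) [NeZero d] (x : K) :
    diag K d * lower (d * x) = lower x * diag K d := by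
  ext i j
  fin_cases i <;> fin_cases j <;> simp [Matrix.mul_apply, Fin.sum_univ_two, mul_comm]

end Field

theorem map_diag (d : ℕ) [NeZero d] : (diag ℚ d).map (Rat.castHom ℝ) = diag ℝ d := by
  ext i j
  fin_cases i <;> fin_cases j <;> simp

theorem map_upperRightHom (x : ℚ) :
    (upperRightHom x).map (Rat.castHom ℝ) = upperRightHom (x : ℝ) := by
  ext i j
  fin_cases i <;> fin_cases j <;> simp

theorem map_lower (x : ℚ) : (lower x).map (Rat.castHom ℝ) = lower (x : ℝ) := by
  ext i j
  fin_cases i <;> fin_cases j <;> simp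

/-- The integral lower triangular unipotent matrix with entry `n`. -/
def lowerSL (n : ℤ) : SL(2, ℤ) := ⟨!![1, 0; n, 1], by simp⟩

theorem mapGL_lowerSL (n : ℤ) : mapGL ℝ (lowerSL n) = lower (n : ℝ) := by
  ext i j
  rw [Matrix.SpecialLinearGroup.mapGL_coe_matrix, Matrix.SpecialLinearGroup.map_apply_coe]
  fin_cases i <;> fin_cases j <;> simp [lowerSL]

theorem mapGL_T_pow (n : ℕ) : mapGL ℝ (ModularGroup.T ^ n) = upperRightHom (n : ℝ) := by
  ext i j
  rw [← zpow_natCast]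
  fin_cases i <;> fin_cases j <;>
    simp [-zpow_natCast, -map_zpow, Matrix.SpecialLinearGroup.mapGL_coe_matrix,
      ModularGroup.coe_T_zpow]

theorem T_pow_mul_apply_zero_one (n : ℕ) (γ : SL(2, ℤ)) :
    (ModularGroup.T ^ n * γ) 0 1 = γ 0 1 + n * γ 1 1 := by
  rw [← zpow_natCast, Matrix.SpecialLinearGroup.coe_mul, ModularGroup.coe_T_zpow]
  simp [Matrix.mul_apply, Fin.sum_univ_two]

theorem T_pow_mul_apply_one_zero (n : ℕ) (γ : SL(2, ℤ)) :
    (ModularGroup.T ^ n * γ) 1 0 = γ 1 0 := by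
  rw [← zpow_natCast, Matrix.SpecialLinearGroup.coe_mul, ModularGroup.coe_T_zpow]
  simp [Matrix.mul_apply, Fin.sum_univ_two]

theorem lowerSL_mul_apply_one_zero (n : ℤ) (γ : SL(2, ℤ)) :
    (lowerSL n * γ) 1 0 = n * γ 0 0 + γ 1 0 := by
  rw [Matrix.SpecialLinearGroup.coe_mul, lowerSL]
  simp [Matrix.mul_apply, Fin.sum_univ_two]

theorem lowerSL_inv (n : ℤ) : (lowerSL n)⁻¹ = lowerSL (-n) := by
  rw [inv_eq_iff_mul_eq_one]
  ext i j
  rw [Matrix.SpecialLinearGroup.coe_mul, lowerSL, lowerSL]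
  fin_cases i <;> fin_cases j <;> simp [Matrix.mul_apply, Fin.sum_univ_two]

theorem mapGL_mul_diag_eq_iff (d : ℕ) [NeZero d] (γ δ : SL(2, ℤ)) :
    mapGL ℝ γ * diag ℝ d = diag ℝ d * mapGL ℝ δ ↔
      γ 0 0 = δ 0 0 ∧ γ 0 1 = d * δ 0 1 ∧ δ 1 0 = d * γ 1 0 ∧ γ 1 1 = δ 1 1 := by
  have hd : (d : ℝ) ≠ 0 := NeZero.ne _
  rw [Units.ext_iff, ← Matrix.ext_iff]
  simp only [Fin.forall_fin_two, Units.val_mul, coe_diag, Matrix.mul_apply, Fin.sum_univ_two,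
    Matrix.SpecialLinearGroup.mapGL_coe_matrix, Matrix.SpecialLinearGroup.map_apply_coe,
    RingHom.mapMatrix_apply, Matrix.map_apply, algebraMap_int_eq, Int.coe_castRingHom,
    Matrix.of_apply, Matrix.cons_val', Matrix.cons_val_zero, Matrix.cons_val_one,
    Matrix.cons_val_fin_one, mul_zero, add_zero, zero_add, mul_one, zero_mul, one_mul]
  rw [mul_comm (d : ℝ), mul_left_inj' hd, mul_comm _ (d : ℝ), eq_comm (b := (d : ℝ) * _)]
  norm_cast
  tauto

theorem exists_sl_apply {a b c d : ℤ} (h : a * d - b * c = 1) :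
    ∃ δ : SL(2, ℤ), δ 0 0 = a ∧ δ 0 1 = b ∧ δ 1 0 = c ∧ δ 1 1 = d :=
  ⟨⟨!![a, b; c, d], by rw [Matrix.det_fin_two_of, h]⟩, rfl, rfl, rfl, rfl⟩

theorem exists_mapGL_eq_diag_conj (d ℓ : ℕ) [NeZero d] {γ : SL(2, ℤ)} (hγ : γ ∈ Gamma0 (d * ℓ)) :
    ∃ δ ∈ Gamma0 ℓ, mapGL ℝ δ = diag ℝ d * mapGL ℝ γ * (diag ℝ d)⁻¹ := by
  obtain ⟨c, hc⟩ := mem_Gamma0_iff_dvd.1 hγ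
  have hdet := γ.det_coe
  rw [Matrix.det_fin_two, hc] at hdet
  push_cast at hdet
  obtain ⟨δ, h₀₀, h₀₁, h₁₀, h₁₁⟩ := exists_sl_apply (a := γ 0 0) (b := d * γ 0 1) (c := ℓ * c)
    (d := γ 1 1) (by linear_combination hdet)
  refine ⟨δ, mem_Gamma0_iff_dvd.2 ⟨c, h₁₀⟩, ?_⟩
  rw [eq_mul_inv_iff_mul_eq, mapGL_mul_diag_eq_iff]
  refine ⟨h₀₀, h₀₁, ?_, h₁₁⟩
  rw [hc, h₁₀]
  push_cast
  exact mul_assoc _ _ _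

theorem mapGL_mem_diag_conj_iff (d ℓ : ℕ) [NeZero d] (γ : SL(2, ℤ)) :
    mapGL ℝ γ ∈ ConjAct.toConjAct (diag ℝ d) • (Gamma0 (d * ℓ)).map (mapGL ℝ) ↔
      γ ∈ Gamma0 ℓ ∧ (d : ℤ) ∣ γ 0 1 := by
  have hd : (d : ℤ) ≠ 0 := NeZero.ne _
  rw [Subgroup.mem_pointwise_smul_iff_inv_smul_mem, ← map_inv, ConjAct.toConjAct_smul,
    inv_inv, Subgroup.mem_map]
  simp only [mem_Gamma0_iff_dvd, mul_assoc, eq_inv_mul_iff_mul_eq,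
    eq_comm (a := diag ℝ d * mapGL ℝ _), mapGL_mul_diag_eq_iff]
  constructor
  · rintro ⟨δ, hδ, -, h₀₁, h₁₀, -⟩
    rw [h₁₀] at hδ
    push_cast at hδ
    exact ⟨(mul_dvd_mul_iff_left hd).1 hδ, _, h₀₁⟩
  · rintro ⟨hγ, b, hb⟩
    have hdet := γ.det_coe
    rw [Matrix.det_fin_two, hb] at hdet
    obtain ⟨δ, h₀₀, h₀₁, h₁₀, h₁₁⟩ := exists_sl_apply (a := γ 0 0) (b := b) (c := d * γ 1 0)
      (d := γ 1 1) (by linear_combination hdet)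
    refine ⟨δ, ?_, h₀₀.symm, by rw [h₀₁, hb], h₁₀, h₁₁.symm⟩
    rw [h₁₀]
    push_cast
    exact mul_dvd_mul_left _ hγ

theorem Gamma0_le_diag_conj {d ℓ q : ℕ} [NeZero d] (h : d * ℓ ∣ q) :
    (Gamma0 q).map (mapGL ℝ) ≤
      ConjAct.toConjAct (diag ℝ d)⁻¹ • (Gamma0 ℓ).map (mapGL ℝ) := by
  rintro _ ⟨γ, hγ, rfl⟩
  obtain ⟨δ, hδ, hconj⟩ := exists_mapGL_eq_diag_conj d ℓ (Gamma0_le_of_dvd h hγ)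
  rw [Subgroup.mem_pointwise_smul_iff_inv_smul_mem, ← map_inv, inv_inv, ConjAct.toConjAct_smul,
    ← hconj]
  exact ⟨δ, hδ, rfl⟩

theorem isFiniteRelIndex_of_isArithmetic (𝒢 ℋ : Subgroup (GL (Fin 2) ℝ)) [h𝒢 : 𝒢.IsArithmetic]
    [hℋ : ℋ.IsArithmetic] : 𝒢.IsFiniteRelIndex ℋ :=
  ⟨(h𝒢.is_commensurable.trans hℋ.is_commensurable.symm).1⟩

theorem isArithmetic_diag_conj_Gamma0 (d ℓ : ℕ) [NeZero d] [NeZero ℓ] :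
    (ConjAct.toConjAct (diag ℝ d) • (Gamma0 ℓ).map (mapGL ℝ)).IsArithmetic := by
  rw [← map_diag]
  exact Subgroup.IsArithmetic.conj _ _

end Matrices

section Raise

open scoped ModularForm

variable {k ℓ : ℕ}

theorem coe_diag_smul (d : ℕ) [NeZero d] (τ : ℍ) : ((diag ℝ d • τ : ℍ) : ℂ) = d * τ := by
  have hd : 0 < (d : ℝ) := by exact_mod_cast NeZero.pos d
  rw [coe_smul_of_det_pos (by simpa using hd)]
  simp [num, denom]

theorem slash_diag_apply (d : ℕ) [NeZero d] (k : ℕ) (f : ℍ → ℂ) (τ : ℍ) :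
    (f ∣[(k : ℤ)] diag ℝ d) τ = (d : ℂ) ^ ((k : ℤ) - 1) * f (diag ℝ d • τ) := by
  have hd : 0 < (d : ℝ) := by exact_mod_cast NeZero.pos d
  rw [ModularForm.slash_apply]
  simp [σ, denom, hd, mul_comm]

theorem smul_slash_of_det_pos (k : ℤ) {g : GL (Fin 2) ℝ} (hg : 0 < g.det.val) (c : ℂ) (f : ℍ → ℂ) :
    (c • f) ∣[k] g = c • (f ∣[k] g) := by
  rw [ModularForm.smul_slash, σ, if_pos hg, ContinuousAlgEquiv.refl_apply]

theorem raise_apply (d : ℕ) [NeZero d] (φ : A k ℓ) (τ : ℍ) :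
    raise d φ τ = (((d : ℝ) ^ ((k : ℝ) / 2) : ℝ) : ℂ) * φ (diag ℝ d • τ) := by
  rw [raise, ← coe_diag_smul, ofComplex_apply]

/-- The scalar relating `φ|_d` to the slash action of `diag(d, 1)`. Mathlib's slash action
carries the factor `det ^ (k - 1)` instead of the unitary normalisation `det ^ (k / 2)`. -/
def raiseConst (k d : ℕ) : ℂ := (((d : ℝ) ^ (1 - (k : ℝ) / 2) : ℝ) : ℂ)

theorem raiseConst_ne_zero (k d : ℕ) [NeZero d] : raiseConst k d ≠ 0 := by
  have hd : 0 < (d : ℝ) := by exact_mod_cast NeZero.pos d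
  rw [raiseConst, Complex.ofReal_ne_zero]
  positivity

theorem raise_eq_smul_slash (d : ℕ) [NeZero d] (φ : A k ℓ) :
    raise d φ = raiseConst k d • (⇑φ ∣[(k : ℤ)] diag ℝ d) := by
  have hd : 0 < (d : ℝ) := by exact_mod_cast NeZero.pos d
  have hpow : (d : ℝ) ^ ((k : ℝ) / 2) = (d : ℝ) ^ (1 - (k : ℝ) / 2) * (d : ℝ) ^ ((k : ℤ) - 1) := by
    rw [← Real.rpow_intCast, ← Real.rpow_add hd]
    congr 1
    push_cast
    ring
  ext τ
  rw [raise_apply, Pi.smul_apply, slash_diag_apply, smul_eq_mul, ← mul_assoc, raiseConst, hpow]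
  push_cast
  rfl

theorem raise_one (φ : A k ℓ) : raise 1 φ = φ := by
  ext τ
  simp [raise]

theorem raise_mul_apply (c d : ℕ) [NeZero c] [NeZero d] (φ : A k ℓ) (τ : ℍ) :
    raise (c * d) φ τ = (((c : ℝ) ^ ((k : ℝ) / 2) : ℝ) : ℂ) * raise d φ (diag ℝ c • τ) := by
  have : NeZero (c * d) := ⟨mul_ne_zero (NeZero.ne c) (NeZero.ne d)⟩
  have hdiag : diag ℝ (c * d) • τ = diag ℝ d • diag ℝ c • τ := by
    ext
    simp only [coe_diag_smul]
    push_cast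
    ring
  rw [raise_apply, raise_apply, ← mul_assoc, ← Complex.ofReal_mul,
    ← Real.mul_rpow (by positivity) (by positivity), hdiag]
  push_cast
  rfl

theorem petersson_raise (d : ℕ) [NeZero d] (φ ψ : A k ℓ) (τ : ℍ) :
    petersson (k : ℤ) (raise d φ) (raise d ψ) τ = petersson k φ ψ (diag ℝ d • τ) := by
  have hd : 0 < (d : ℝ) := by exact_mod_cast NeZero.pos d
  have him : (diag ℝ d • τ).im = d * τ.im := by
    rw [← coe_im, coe_diag_smul]
    simp
  have hsq : (((d : ℝ) ^ ((k : ℝ) / 2) : ℝ) : ℂ) * (((d : ℝ) ^ ((k : ℝ) / 2) : ℝ) : ℂ) =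
      (d : ℂ) ^ k := by
    rw [← Complex.ofReal_mul, ← Real.rpow_add hd, add_halves, Real.rpow_natCast]
    push_cast
    rfl
  simp only [petersson, raise_apply, him, map_mul, Complex.conj_ofReal, zpow_natCast]
  push_cast
  rw [mul_pow, ← hsq]
  ring

/-- Restriction of a cusp form to a smaller group. -/
def restrict {Γ Γ' : Subgroup (GL (Fin 2) ℝ)} {k : ℤ} (h : Γ' ≤ Γ) (f : CuspForm Γ k) :
    CuspForm Γ' k where
  toFun := f
  slash_action_eq' γ hγ := f.slash_action_eq' γ (h hγ)
  holo' := f.holo'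
  zero_at_cusps' hc := f.zero_at_cusps' (hc.mono h)

theorem exists_coe_eq_raise {d q : ℕ} [NeZero d] (h : d * ℓ ∣ q) (φ : A k ℓ) :
    ∃ f : A k q, ⇑f = raise d φ :=
  ⟨raiseConst k d • restrict (Gamma0_le_diag_conj h) (CuspForm.translate φ (diag ℝ d)),
    (raise_eq_smul_slash d φ).symm⟩

/-- The operator `φ ↦ φ|_d` from level `ℓ` to level `q`, for `dℓ ∣ q`. -/
def raiseLin {d q : ℕ} [NeZero d] (h : d * ℓ ∣ q) : A k ℓ →ₗ[ℂ] A k q where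
  toFun φ := (exists_coe_eq_raise h φ).choose
  map_add' φ ψ := by
    ext τ
    simp only [FunLike.coe_add, Pi.add_apply, (exists_coe_eq_raise h _).choose_spec, raise, mul_add]
  map_smul' c φ := by
    ext τ
    simp only [FunLike.coe_smul, Pi.smul_apply, (exists_coe_eq_raise h _).choose_spec, raise,
      smul_eq_mul, RingHom.id_apply, mul_left_comm]

@[simp] theorem coe_raiseLin {d q : ℕ} [NeZero d] (h : d * ℓ ∣ q) (φ : A k ℓ) :
    ⇑(raiseLin h φ) = raise d φ :=
  (exists_coe_eq_raise h φ).choose_spec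

theorem inner_raiseLin {d q : ℕ} [NeZero d] [NeZero q] (h : d * ℓ ∣ q) (V : ℝ)
    (φ ψ : A k ℓ) : inner V (raiseLin h φ) (raiseLin h ψ) = inner V φ ψ := by
  simp only [inner, coe_raiseLin, petersson_raise]
  exact congrArg (_ * ·) (setAverage_fdOf_smul (neg_one_mem_Gamma0 q) (neg_one_mem_Gamma0 ℓ)
    (fun γ hγ ↦ exists_mapGL_eq_diag_conj d ℓ (Gamma0_le_of_dvd h hγ))
    fun γ hγ ↦ petersson_smul_of_mem_Gamma0 φ ψ hγ)

theorem raise_mul_eq_smul_slash (c d : ℕ) [NeZero c] [NeZero d] (φ : A k ℓ) :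
    raise (c * d) φ = raiseConst k c • (raise d φ ∣[(k : ℤ)] diag ℝ c) := by
  rw [← coe_raiseLin (dvd_refl (d * ℓ)), ← raise_eq_smul_slash]
  ext τ
  rw [raise_mul_apply, raise_apply c (raiseLin _ φ), coe_raiseLin]

end Raise

section Averages

open scoped Pointwise ModularForm

variable {k p ℓ : ℕ}

/-- The average of `f` over translations by multiples of `1 / p`. -/
def upperAvg (k p : ℕ) [NeZero p] (f : ℍ → ℂ) : ℍ → ℂ :=
  (p : ℂ)⁻¹ • ∑ b : ZMod p, f ∣[(k : ℤ)] upperRightHom ((b.val : ℝ) / p)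

/-- The average of `f` over the lower unipotents with entries `0, r, …, (p - 1) r`. -/
def lowerAvg (k p r : ℕ) [NeZero p] (f : ℍ → ℂ) : ℍ → ℂ :=
  (p : ℂ)⁻¹ • ∑ b : ZMod p, f ∣[(k : ℤ)] lower ((b.val : ℝ) * r)

theorem coe_trace_eq_sum {𝒢 ℋ : Subgroup (GL (Fin 2) ℝ)} {k : ℤ} [𝒢.IsFiniteRelIndex ℋ]
    (f : CuspForm 𝒢 k) {ι : Type*} [Fintype ι] (r : ι → GL (Fin 2) ℝ) (hr : ∀ i, r i ∈ ℋ)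
    (hinj : ∀ i j, r i * (r j)⁻¹ ∈ 𝒢 → i = j) (hsurj : ∀ h ∈ ℋ, ∃ i, r i * h ∈ 𝒢) :
    ⇑(CuspForm.trace ℋ f) = ∑ i, ⇑f ∣[k] r i := by
  let := Fintype.ofFinite (ℋ ⧸ 𝒢.subgroupOf ℋ)
  let coset : ι → ℋ ⧸ 𝒢.subgroupOf ℋ := fun i ↦ ((⟨r i, hr i⟩⁻¹ : ℋ) : ℋ ⧸ 𝒢.subgroupOf ℋ)
  have hcoset : Function.Bijective coset := by
    refine ⟨fun i j hij ↦ hinj i j ?_, Quotient.forall.2 fun ⟨h, hh⟩ ↦ ?_⟩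
    · simpa [Subgroup.mem_subgroupOf] using QuotientGroup.eq.1 hij
    · obtain ⟨i, hi⟩ := hsurj h hh
      exact ⟨i, QuotientGroup.eq.2 (by simpa [Subgroup.mem_subgroupOf] using hi)⟩
  rw [CuspForm.coe_trace]
  refine (hcoset.sum_comp (SlashInvariantForm.quotientFunc f)).symm.trans
    (Finset.sum_congr rfl fun i _ ↦ ?_)
  exact (SlashInvariantForm.quotientFunc_mk (f := f) (⟨r i, hr i⟩⁻¹ : ℋ)).trans (by simp)

theorem intCast_mul_eq_one_of_dvd {γ : SL(2, ℤ)} (h : (p : ℤ) ∣ γ 1 0) :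
    ((γ 0 0 : ℤ) : ZMod p) * (γ 1 1 : ℤ) = 1 := by
  have hdet := congrArg (Int.cast : ℤ → ZMod p) γ.det_coe
  rw [← ZMod.intCast_zmod_eq_zero_iff_dvd] at h
  rw [Matrix.det_fin_two] at hdet
  push_cast at hdet
  rwa [h, mul_zero, sub_zero] at hdet

theorem exists_dvd_val_mul_add [NeZero p] {a a' : ℤ} (h : (a : ZMod p) * a' = 1) (b : ℤ) :
    ∃ x : ZMod p, (p : ℤ) ∣ x.val * a + b := by
  refine ⟨-b * a', ?_⟩
  rw [← ZMod.intCast_zmod_eq_zero_iff_dvd]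
  push_cast
  rw [ZMod.natCast_zmod_val]
  linear_combination -(b : ZMod p) * h

theorem eq_of_dvd_val_sub_val [NeZero p] {a b : ZMod p} (h : (p : ℤ) ∣ (a.val : ℤ) - b.val) :
    a = b := by
  rw [← ZMod.intCast_zmod_eq_zero_iff_dvd] at h
  push_cast at h
  rw [ZMod.natCast_zmod_val, ZMod.natCast_zmod_val] at h
  exact sub_eq_zero.1 h

theorem exists_coe_eq_sum_slash_T_pow [NeZero p] [NeZero ℓ] (hpl : p ∣ ℓ) (φ : A k (p * ℓ)) :
    ∃ ψ : A k ℓ, ⇑ψ = ∑ b : ZMod p,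
      (⇑φ ∣[(k : ℤ)] (diag ℝ p)⁻¹) ∣[(k : ℤ)] mapGL ℝ (ModularGroup.T ^ b.val) := by
  have : NeZero (p * ℓ) := ⟨mul_ne_zero (NeZero.ne p) (NeZero.ne ℓ)⟩
  have harith := isArithmetic_diag_conj_Gamma0 p (p * ℓ)
  rw [← inv_inv (diag ℝ p)] at harith
  have hfin := isFiniteRelIndex_of_isArithmetic
    (ConjAct.toConjAct (diag ℝ p)⁻¹⁻¹ • (Gamma0 (p * ℓ)).map (mapGL ℝ))
    ((Gamma0 ℓ).map (mapGL ℝ))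
  refine ⟨_, coe_trace_eq_sum (CuspForm.translate φ (diag ℝ p)⁻¹)
    (fun b : ZMod p ↦ mapGL ℝ (ModularGroup.T ^ b.val)) (fun b ↦ ?_) (fun a b h ↦ ?_) ?_⟩
  · refine Subgroup.mem_map_of_mem _ ?_
    rw [mem_Gamma0_iff_dvd, ← mul_one (ModularGroup.T ^ b.val), T_pow_mul_apply_one_zero]
    simp
  · rw [← map_inv, ← map_mul, inv_inv, mapGL_mem_diag_conj_iff, ← zpow_natCast, ← zpow_natCast,
      ← zpow_sub, ModularGroup.coe_T_zpow] at h
    exact eq_of_dvd_val_sub_val (by simpa using h.2)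
  · rintro _ ⟨γ, hγ, rfl⟩
    have hmul := intCast_mul_eq_one_of_dvd
      ((Int.natCast_dvd_natCast.2 hpl).trans (mem_Gamma0_iff_dvd.1 hγ))
    obtain ⟨x, hx⟩ := exists_dvd_val_mul_add ((mul_comm _ _).trans hmul) (γ 0 1)
    refine ⟨x, ?_⟩
    rw [← map_mul, inv_inv, mapGL_mem_diag_conj_iff, mem_Gamma0_iff_dvd, T_pow_mul_apply_one_zero,
      T_pow_mul_apply_zero_one, add_comm]
    exact ⟨mem_Gamma0_iff_dvd.1 hγ, hx⟩

theorem exists_raise_eq_upperAvg [NeZero p] [NeZero ℓ] (hpl : p ∣ ℓ) (φ : A k (p * ℓ)) :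
    ∃ ψ : A k ℓ, raise p ψ = upperAvg k p φ := by
  have hp : (p : ℝ) ≠ 0 := NeZero.ne _
  obtain ⟨ψ, hψ⟩ := exists_coe_eq_sum_slash_T_pow hpl φ
  refine ⟨((p : ℂ)⁻¹ * (raiseConst k p)⁻¹) • ψ, ?_⟩
  rw [raise_eq_smul_slash, FunLike.coe_smul,
    smul_slash_of_det_pos _ (by simpa using NeZero.pos p), smul_smul, mul_left_comm,
    mul_inv_cancel₀ (raiseConst_ne_zero k p), mul_one, upperAvg, hψ, SlashAction.sum_slash]
  refine congrArg _ (Finset.sum_congr rfl fun b _ ↦ ?_)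
  rw [← SlashAction.slash_mul, ← SlashAction.slash_mul, mapGL_T_pow]
  congr 1
  rw [inv_mul_eq_iff_eq_mul, diag_mul_upper, mul_div_cancel₀ _ hp]

theorem exists_coe_eq_lowerAvg [NeZero p] [NeZero ℓ] (hpl : p ∣ ℓ) (φ : A k (p * ℓ)) :
    ∃ ψ : A k ℓ, ⇑ψ = lowerAvg k p ℓ φ := by
  have hℓ : (ℓ : ℤ) ≠ 0 := NeZero.ne _
  have : NeZero (p * ℓ) := ⟨mul_ne_zero (NeZero.ne p) (NeZero.ne ℓ)⟩
  have hfin := isFiniteRelIndex_of_isArithmetic ((Gamma0 (p * ℓ)).map (mapGL ℝ))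
    ((Gamma0 ℓ).map (mapGL ℝ))
  have hmem {γ : SL(2, ℤ)} {N : ℕ} : mapGL ℝ γ ∈ (Gamma0 N).map (mapGL ℝ) ↔ γ ∈ Gamma0 N :=
    Subgroup.mem_map_iff_mem Matrix.SpecialLinearGroup.mapGL_injective
  have htrace := coe_trace_eq_sum (ℋ := (Gamma0 ℓ).map (mapGL ℝ)) φ
    (fun b : ZMod p ↦ mapGL ℝ (lowerSL (b.val * ℓ))) (fun b ↦ ?_) (fun a b h ↦ ?_) ?_
  · refine ⟨(p : ℂ)⁻¹ • CuspForm.trace ((Gamma0 ℓ).map (mapGL ℝ)) φ, ?_⟩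
    simp only [FunLike.coe_smul, htrace, lowerAvg, mapGL_lowerSL, Int.cast_mul, Int.cast_natCast]
  · rw [hmem, mem_Gamma0_iff_dvd]
    exact dvd_mul_left (ℓ : ℤ) b.val
  · rw [← map_inv, ← map_mul, hmem, mem_Gamma0_iff_dvd, lowerSL_mul_apply_one_zero,
      lowerSL_inv] at h
    have hdvd : (p : ℤ) * ℓ ∣ (a.val - b.val) * ℓ := by
      simpa [lowerSL, add_mul, sub_eq_add_neg] using h
    exact eq_of_dvd_val_sub_val ((mul_dvd_mul_iff_right hℓ).1 hdvd)
  · rintro _ ⟨γ, hγ, rfl⟩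
    obtain ⟨c, hc⟩ := mem_Gamma0_iff_dvd.1 hγ
    have hmul := intCast_mul_eq_one_of_dvd
      ((Int.natCast_dvd_natCast.2 hpl).trans (mem_Gamma0_iff_dvd.1 hγ))
    obtain ⟨x, y, hxy⟩ := exists_dvd_val_mul_add hmul c
    refine ⟨x, ?_⟩
    rw [← map_mul, hmem, mem_Gamma0_iff_dvd, lowerSL_mul_apply_one_zero, hc]
    refine ⟨y, ?_⟩
    push_cast
    linear_combination (ℓ : ℤ) * hxy

theorem slash_upper_intCast (φ : A k ℓ) (n : ℤ) : ⇑φ ∣[(k : ℤ)] upperRightHom (n : ℝ) = φ := by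
  refine SlashInvariantFormClass.slash_action_eq φ _ ?_
  rw [← Subgroup.mem_strictPeriods_iff, strictPeriods_Gamma0]
  exact ⟨n, by simp⟩

theorem slash_lower_intCast (φ : A k ℓ) {n : ℤ} (hn : (ℓ : ℤ) ∣ n) :
    ⇑φ ∣[(k : ℤ)] lower (n : ℝ) = φ := by
  refine SlashInvariantFormClass.slash_action_eq φ _ ?_
  rw [← mapGL_lowerSL]
  exact Subgroup.mem_map_of_mem _ (mem_Gamma0_iff_dvd.2 hn)

theorem raise_slash_upper (d : ℕ) [NeZero d] (φ : A k ℓ) (x : ℝ) :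
    raise d φ ∣[(k : ℤ)] upperRightHom x =
      raiseConst k d • ((⇑φ ∣[(k : ℤ)] upperRightHom (d * x)) ∣[(k : ℤ)] diag ℝ d) := by
  rw [raise_eq_smul_slash, smul_slash_of_det_pos _ (by simp), ← SlashAction.slash_mul,
    diag_mul_upper, SlashAction.slash_mul]

theorem raise_slash_lower (d : ℕ) [NeZero d] (φ : A k ℓ) (x : ℝ) :
    raise d φ ∣[(k : ℤ)] lower (d * x) =
      raiseConst k d • ((⇑φ ∣[(k : ℤ)] lower x) ∣[(k : ℤ)] diag ℝ d) := by
  rw [raise_eq_smul_slash, smul_slash_of_det_pos _ (by simp), ← SlashAction.slash_mul,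
    diag_mul_lower, SlashAction.slash_mul]

theorem sum_mul_val_eq_sum_val {E : Type*} [AddCommMonoid E] [NeZero p] {d : ℕ}
    (hd : d.Coprime p) {F : ℤ → E} (hF : Function.Periodic F p) :
    ∑ b : ZMod p, F (d * b.val) = ∑ b : ZMod p, F b.val := by
  refine Fintype.sum_equiv (ZMod.unitOfCoprime d hd).mulLeft _ _ fun b ↦ ?_
  have hval : (((ZMod.unitOfCoprime d hd).mulLeft b).val : ℤ) = (d * b.val : ℤ) % p := by
    rw [← ZMod.val_intCast]
    simp
  rw [hval, Int.emod_def, mul_comm (p : ℤ)]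
  exact (hF.sub_zsmul_eq (d * b.val / p : ℤ)).symm

theorem exists_upperAvg_mem_raised [NeZero p] [NeZero ℓ] {d q : ℕ} [NeZero d]
    (hdvd : d * p * ℓ ∣ q) (hpl : p ∣ ℓ) (hpd : d.Coprime p) {f : A k q}
    (hf : f ∈ raised k q (p * ℓ) d) : ∃ u ∈ raised k q ℓ (d * p), ⇑u = upperAvg k p f := by
  have hp : (p : ℝ) ≠ 0 := NeZero.ne _
  have : NeZero (d * p) := ⟨mul_ne_zero (NeZero.ne d) (NeZero.ne p)⟩
  obtain ⟨φ, hφ⟩ := hf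
  obtain ⟨ψ, hψ⟩ := exists_raise_eq_upperAvg hpl φ
  have hperiodic : Function.Periodic
      (fun n : ℤ ↦ ⇑φ ∣[(k : ℤ)] upperRightHom ((n : ℝ) / p)) p := fun n ↦ by
    have hshift : ((n + p : ℤ) : ℝ) / p = ((1 : ℤ) : ℝ) + n / p := by
      push_cast
      field_simp
      ring
    simp only [hshift, AddChar.map_add_eq_mul, SlashAction.slash_mul, slash_upper_intCast]
  have hsum := sum_mul_val_eq_sum_val hpd hperiodic
  simp only [Int.cast_mul, Int.cast_natCast, mul_div_assoc] at hsum
  refine ⟨raiseLin hdvd ψ, ⟨ψ, coe_raiseLin _ _⟩, ?_⟩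
  rw [coe_raiseLin, raise_mul_eq_smul_slash, hψ, upperAvg,
    smul_slash_of_det_pos _ (by simpa using NeZero.pos d), upperAvg, hφ, smul_comm]
  simp only [raise_slash_upper, ← Finset.smul_sum, ← SlashAction.sum_slash, hsum]

theorem exists_lowerAvg_mem_raised [NeZero p] [NeZero ℓ] {d e q : ℕ} [NeZero d]
    (hdvd : d * ℓ ∣ q) (hpl : p ∣ ℓ) (hpe : e.Coprime p) {f : A k q}
    (hf : f ∈ raised k q (p * ℓ) d) :
    ∃ u ∈ raised k q ℓ d, ⇑u = lowerAvg k p (d * (e * ℓ)) f := by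
  obtain ⟨φ, hφ⟩ := hf
  obtain ⟨ψ, hψ⟩ := exists_coe_eq_lowerAvg hpl φ
  have hperiodic : Function.Periodic (fun n : ℤ ↦ ⇑φ ∣[(k : ℤ)] lower ((n : ℝ) * ℓ)) p :=
    fun n ↦ by
    have hshift : ((n + p : ℤ) : ℝ) * ℓ = (((p * ℓ : ℕ) : ℤ) : ℝ) + n * ℓ := by
      push_cast
      ring
    simp only [hshift, lower_add, SlashAction.slash_mul, slash_lower_intCast φ dvd_rfl]
  have hsum := sum_mul_val_eq_sum_val hpe hperiodic
  have hterm (b : ZMod p) : raise d φ ∣[(k : ℤ)] lower ((b.val : ℝ) * (d * (e * ℓ) : ℕ)) =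
      raiseConst k d • ((⇑φ ∣[(k : ℤ)] lower (((e * b.val : ℤ) : ℝ) * ℓ)) ∣[(k : ℤ)] diag ℝ d) := by
    rw [← raise_slash_lower]
    congr 2
    push_cast
    ring
  refine ⟨raiseLin hdvd ψ, ⟨ψ, coe_raiseLin _ _⟩, ?_⟩
  rw [coe_raiseLin, raise_eq_smul_slash, hψ, lowerAvg,
    smul_slash_of_det_pos _ (by simpa using NeZero.pos d), lowerAvg, hφ, smul_comm]
  simp only [hterm, ← Finset.smul_sum, ← SlashAction.sum_slash, hsum, Int.cast_natCast]

end Averages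

section InnerAverages

open scoped ModularForm

variable {k q : ℕ}

theorem petersson_slash_of_slash_eq {k : ℤ} {g : GL (Fin 2) ℝ} (hdet : g.det.val = 1) {w : ℍ → ℂ}
    (hw : w ∣[k] g = w) (f : ℍ → ℂ) (τ : ℍ) :
    petersson k w (f ∣[k] g) τ = petersson k w f (g • τ) := by
  have h := petersson_slash k w f g τ
  rw [hw, hdet, σ, if_pos (by rw [hdet]; exact one_pos)] at h
  simpa using h

theorem petersson_smul_sum (k : ℤ) {ι : Type*} [Fintype ι] (w : ℍ → ℂ) (c : ℂ) (F : ι → ℍ → ℂ)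
    (τ : ℍ) : petersson k w (c • ∑ i, F i) τ = c * ∑ i, petersson k w (F i) τ := by
  simp only [petersson, Pi.smul_apply, Finset.sum_apply, smul_eq_mul, ← Finset.sum_mul,
    ← Finset.mul_sum]
  ring

theorem exists_finiteIndex_conj_le_Gamma0 (q : ℕ) [NeZero q] {ι : Type*} [Finite ι]
    (g : ι → GL (Fin 2) ℚ) :
    ∃ Γ ≤ Gamma0 q, Γ.FiniteIndex ∧ -1 ∈ Γ ∧ ∀ i, ∀ γ ∈ Γ, ∃ δ ∈ Gamma0 q,
      mapGL ℝ δ = (g i).map (Rat.castHom ℝ) * mapGL ℝ γ * ((g i).map (Rat.castHom ℝ))⁻¹ := by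
  have hindex := Subgroup.finiteIndex_iInf fun i ↦
    ((Gamma0_is_congruence q).conjGL (g i)).finiteIndex
  refine ⟨Gamma0 q ⊓ ⨅ i, conjGL (Gamma0 q) ((g i).map (Rat.castHom ℝ)), inf_le_left,
    inferInstance, ⟨neg_one_mem_Gamma0 q, Subgroup.mem_iInf.2 fun i ↦
      mem_conjGL.2 ⟨-1, neg_one_mem_Gamma0 q, ?_⟩⟩,
    fun i γ hγ ↦ mem_conjGL.1 (Subgroup.mem_iInf.1 hγ.2 i)⟩
  have hneg : ((-1 : SL(2, ℤ)) : GL (Fin 2) ℝ) = -1 := by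
    ext i j
    simp
  rw [hneg]
  simp

/-- Unfold to a subgroup `Γ` on which all the functions `f ∣[k] g i` are invariant; a change of
variables by `g i` then removes the matrices, as they fix `w`. -/
theorem inner_eq_of_coe_eq_average [NeZero q] (V : ℝ) {ι : Type*} [Fintype ι] [Nonempty ι]
    {g : ι → GL (Fin 2) ℚ} (hdet : ∀ i, ((g i).map (Rat.castHom ℝ)).det.val = 1) {w f u : A k q}
    (hw : ∀ i, ⇑w ∣[(k : ℤ)] (g i).map (Rat.castHom ℝ) = w)
    (hu : ⇑u = (Fintype.card ι : ℂ)⁻¹ • ∑ i, ⇑f ∣[(k : ℤ)] (g i).map (Rat.castHom ℝ)) :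
    inner V w u = inner V w f := by
  obtain ⟨Γ, hΓ, hfin, hneg, hconj⟩ := exists_finiteIndex_conj_le_Gamma0 q g
  obtain ⟨C, hC⟩ := CuspFormClass.petersson_bounded_left k ((Gamma0 q).map (mapGL ℝ)) w f
  have hcard : (Fintype.card ι : ℂ) ≠ 0 := by simp [Fintype.card_ne_zero]
  have hpetersson (τ : ℍ) : petersson (k : ℤ) w u τ = (Fintype.card ι : ℂ)⁻¹ *
      ∑ i, petersson (k : ℤ) w f ((g i).map (Rat.castHom ℝ) • τ) := by
    simp only [hu, petersson_smul_sum, petersson_slash_of_slash_eq (hdet _) (hw _)]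
  have hintegrable (i : ι) :
      IntegrableOn (fun τ ↦ petersson (k : ℤ) w f ((g i).map (Rat.castHom ℝ) • τ)) (fdOf Γ) :=
    Measure.integrableOn_of_bounded (M := C) (volume_fdOf_lt_top Γ).ne
      ((petersson_continuous _ (ModularFormClass.continuous w) (ModularFormClass.continuous f)).comp
        (continuous_const_smul _)).aestronglyMeasurable (.of_forall fun τ ↦ hC _)
  suffices haverage : ⨍ τ in fundDomain q, petersson (k : ℤ) w u τ =
      ⨍ τ in fundDomain q, petersson (k : ℤ) w f τ from congrArg (_ * ·) haverage
  calc ⨍ τ in fundDomain q, petersson (k : ℤ) w u τ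
      = ⨍ τ in fdOf Γ, petersson (k : ℤ) w u ((1 : GL (Fin 2) ℝ) • τ) :=
        (setAverage_fdOf_smul hneg (neg_one_mem_Gamma0 q) (fun γ hγ ↦ ⟨γ, hΓ hγ, by simp⟩)
          fun γ hγ ↦ petersson_smul_of_mem_Gamma0 w u hγ).symm
    _ = (Fintype.card ι : ℂ)⁻¹ *
        ∑ i, ⨍ τ in fdOf Γ, petersson (k : ℤ) w f ((g i).map (Rat.castHom ℝ) • τ) := by
      simp only [one_smul, setAverage_eq, hpetersson, integral_const_mul,
        integral_finsetSum _ fun i _ ↦ hintegrable i, Complex.real_smul, ← Finset.mul_sum]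
      ring
    _ = (Fintype.card ι : ℂ)⁻¹ * ∑ _i : ι, ⨍ τ in fundDomain q, petersson (k : ℤ) w f τ := by
      refine congrArg _ (Finset.sum_congr rfl fun i _ ↦ ?_)
      exact setAverage_fdOf_smul hneg (neg_one_mem_Gamma0 q) (hconj i)
        fun γ hγ ↦ petersson_smul_of_mem_Gamma0 w f hγ
    _ = ⨍ τ in fundDomain q, petersson (k : ℤ) w f τ := by
      rw [Finset.sum_const, Finset.card_univ, nsmul_eq_mul, inv_mul_cancel_left₀ hcard]

theorem slash_upper_of_mem_raised {ℓ d p : ℕ} [NeZero d] [NeZero p] (hpd : p ∣ d) {f : A k q}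
    (hf : f ∈ raised k q ℓ d) (b : ℕ) : ⇑f ∣[(k : ℤ)] upperRightHom ((b : ℝ) / p) = f := by
  obtain ⟨φ, hφ⟩ := hf
  obtain ⟨c, rfl⟩ := hpd
  have hp : (p : ℝ) ≠ 0 := NeZero.ne _
  have hinteger : ((p * c : ℕ) : ℝ) * (b / p) = ((c * b : ℤ) : ℝ) := by
    push_cast
    field_simp
  rw [hφ, raise_slash_upper, hinteger, slash_upper_intCast, ← raise_eq_smul_slash]

theorem slash_lower_of_mem_raised {ℓ d r : ℕ} [NeZero d] (hr : d * ℓ ∣ r) {f : A k q}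
    (hf : f ∈ raised k q ℓ d) (b : ℕ) : ⇑f ∣[(k : ℤ)] lower ((b : ℝ) * r) = f := by
  obtain ⟨φ, hφ⟩ := hf
  obtain ⟨c, rfl⟩ := hr
  have hinteger : (b : ℝ) * ((d * ℓ * c : ℕ) : ℝ) = d * ((ℓ * (c * b) : ℤ) : ℝ) := by
    push_cast
    ring
  rw [hφ, hinteger, raise_slash_lower, slash_lower_intCast φ (dvd_mul_right _ _),
    ← raise_eq_smul_slash]

theorem inner_eq_of_coe_eq_upperAvg {p ℓ d : ℕ} [NeZero p] [NeZero q] [NeZero d] (V : ℝ)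
    (hpd : p ∣ d) {w f u : A k q} (hw : w ∈ raised k q ℓ d) (hu : ⇑u = upperAvg k p f) :
    inner V w u = inner V w f := by
  have hmap (b : ZMod p) : (upperRightHom ((b.val : ℚ) / p)).map (Rat.castHom ℝ) =
      upperRightHom ((b.val : ℝ) / p) := by
    rw [map_upperRightHom, Rat.cast_div, Rat.cast_natCast, Rat.cast_natCast]
  refine inner_eq_of_coe_eq_average V (g := fun b : ZMod p ↦ upperRightHom ((b.val : ℚ) / p))
    (fun b ↦ by rw [hmap]; simp) (fun b ↦ ?_) ?_
  · rw [hmap, slash_upper_of_mem_raised hpd hw]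
  · simp only [hu, upperAvg, ZMod.card, hmap]

theorem inner_eq_of_coe_eq_lowerAvg {p ℓ d r : ℕ} [NeZero p] [NeZero q] [NeZero d] (V : ℝ)
    (hr : d * ℓ ∣ r) {w f u : A k q} (hw : w ∈ raised k q ℓ d) (hu : ⇑u = lowerAvg k p r f) :
    inner V w u = inner V w f := by
  have hmap (b : ZMod p) : (lower ((b.val : ℚ) * r)).map (Rat.castHom ℝ) =
      lower ((b.val : ℝ) * r) := by
    rw [map_lower, Rat.cast_mul, Rat.cast_natCast, Rat.cast_natCast]
  refine inner_eq_of_coe_eq_average V (g := fun b : ZMod p ↦ lower ((b.val : ℚ) * r))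
    (fun b ↦ by rw [hmap]; simp) (fun b ↦ ?_) ?_
  · rw [hmap, slash_lower_of_mem_raised hr hw]
  · simp only [hu, lowerAvg, ZMod.card, hmap]

end InnerAverages

section RaisedSubmodule

/-- The space of forms `φ|_d` with `φ` of level `q / (d * e)`, the range of the projector
`E_{d..de}`. -/
def raisedSubmodule (k q d e : ℕ) : Submodule ℂ (A k q) where
  carrier := raised k q (q / (d * e)) d
  add_mem' := by
    rintro f g ⟨φ, hφ⟩ ⟨ψ, hψ⟩
    refine ⟨φ + ψ, ?_⟩
    ext τ
    simp only [FunLike.coe_add, hφ, hψ, raise, Pi.add_apply, mul_add]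
  zero_mem' := ⟨0, by ext τ; simp [raise]⟩
  smul_mem' := by
    rintro c f ⟨φ, hφ⟩
    refine ⟨c • φ, ?_⟩
    ext τ
    simp only [FunLike.coe_smul, hφ, raise, Pi.smul_apply, smul_eq_mul, mul_left_comm]

variable {k q : ℕ}

theorem raisedSubmodule_one_one : raisedSubmodule k q 1 1 = ⊤ := by
  refine eq_top_iff.2 fun f _ ↦ ?_
  change f ∈ raised k q (q / (1 * 1)) 1
  rw [mul_one, Nat.div_one]
  exact ⟨f, (raise_one f).symm⟩

theorem raised_mul_subset {ℓ c d m : ℕ} [NeZero c] [NeZero d] (h : d * ℓ ∣ m) :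
    raised k q ℓ (c * d) ⊆ raised k q m c := by
  rintro f ⟨φ, hφ⟩
  refine ⟨raiseLin h φ, ?_⟩
  ext τ
  rw [hφ, raise_mul_apply, raise_apply c (raiseLin h φ), coe_raiseLin]

theorem raisedSubmodule_le [NeZero q] {d d' e e' : ℕ} (hd : d ∣ d') (he : e ∣ e')
    (h : d' * e' ∣ q) : raisedSubmodule k q d' e' ≤ raisedSubmodule k q d e := by
  obtain ⟨c, rfl⟩ := hd
  obtain ⟨a, rfl⟩ := he
  obtain ⟨ℓ, hℓ⟩ := h
  have hq : d * c * (e * a) * ℓ ≠ 0 := hℓ ▸ NeZero.ne q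
  simp only [mul_ne_zero_iff] at hq
  obtain ⟨⟨⟨hd, hc⟩, he, ha⟩, -⟩ := hq
  have : NeZero d := ⟨hd⟩
  have : NeZero c := ⟨hc⟩
  refine raised_mul_subset (k := k) (q := q) ?_
  rw [Nat.div_eq_of_eq_mul_right (by positivity) hℓ,
    Nat.div_eq_of_eq_mul_right (k := c * a * ℓ) (by positivity) (by rw [hℓ]; ring)]
  exact ⟨a, by ring⟩

theorem raisedSubmodule_le_oldspace [NeZero q] {d e : ℕ} (hde : d * e ∣ q) (hne : d * e ≠ 1) :
    raisedSubmodule k q d e ≤ oldspace k q := by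
  have hpos : 0 < d * e := Nat.pos_of_dvd_of_pos hde (NeZero.pos q)
  refine fun f hf ↦ Submodule.subset_span ⟨q / (d * e), d, Nat.div_dvd_of_dvd hde,
    (Nat.div_lt_self (NeZero.pos q) (by omega)).ne, ?_, hf⟩
  rw [Nat.div_div_self hde (NeZero.ne q)]
  exact dvd_mul_right d e

theorem exists_mem_raisedSubmodule_of_mem_raised [NeZero q] {ℓ d : ℕ} (hℓ : ℓ ∣ q) (hne : ℓ ≠ q)
    (hd : d ∣ q / ℓ) {f : A k q} (hf : f ∈ raised k q ℓ d) :
    ∃ e, d * e ∣ q ∧ d * e ≠ 1 ∧ f ∈ raisedSubmodule k q d e := by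
  obtain ⟨e, he⟩ := hd
  have hq : q = d * e * ℓ := by rw [← he, Nat.div_mul_cancel hℓ]
  refine ⟨e, ⟨ℓ, hq⟩, fun h ↦ hne (by rw [hq, h, one_mul]), ?_⟩
  have hlevel : q / (d * e) = ℓ := by rw [← he, Nat.div_div_self hℓ (NeZero.ne q)]
  exact (hlevel ▸ hf : f ∈ raised k q (q / (d * e)) d)

theorem oldspace_eq_iSup [NeZero q] : oldspace k q =
    ⨆ p : {p : ℕ // p.Prime ∧ p ∣ q}, raisedSubmodule k q p 1 ⊔ raisedSubmodule k q 1 p := by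
  refine le_antisymm (Submodule.span_le.2 ?_) (iSup_le fun ⟨p, hp, hpq⟩ ↦ sup_le ?_ ?_)
  · rintro f ⟨ℓ, d, hℓ, hne, hd, hf⟩
    obtain ⟨e, hdeq, hde, hf⟩ := exists_mem_raisedSubmodule_of_mem_raised hℓ hne hd hf
    obtain ⟨p, hp, hpde⟩ := Nat.exists_prime_and_dvd hde
    refine Submodule.mem_iSup_of_mem ⟨p, hp, hpde.trans hdeq⟩ ?_
    rcases hp.dvd_mul.1 hpde with hpd | hpe
    · exact Submodule.mem_sup_left (raisedSubmodule_le hpd (one_dvd e) hdeq hf)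
    · exact Submodule.mem_sup_right (raisedSubmodule_le (one_dvd d) hpe hdeq hf)
  · exact raisedSubmodule_le_oldspace (by rwa [mul_one]) (by rw [mul_one]; exact hp.ne_one)
  · exact raisedSubmodule_le_oldspace (by rwa [one_mul]) (by rw [one_mul]; exact hp.ne_one)

end RaisedSubmodule

section RaiseIsometry

variable {k ℓ d q : ℕ} [NeZero d]

theorem raiseLin_injective (h : d * ℓ ∣ q) :
    Function.Injective (raiseLin h : A k ℓ →ₗ[ℂ] A k q) := by
  intro φ ψ heq
  have hconst : (((d : ℝ) ^ ((k : ℝ) / 2) : ℝ) : ℂ) ≠ 0 := by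
    have := NeZero.pos d
    exact_mod_cast (by positivity : (d : ℝ) ^ ((k : ℝ) / 2) ≠ 0)
  ext τ
  have hτ := DFunLike.congr_fun heq ((diag ℝ d)⁻¹ • τ)
  rw [coe_raiseLin, coe_raiseLin, raise_apply, raise_apply, smul_inv_smul] at hτ
  exact mul_left_cancel₀ hconst hτ

theorem IsOrthonormalBasis.image_raiseLin [NeZero q] (h : d * ℓ ∣ q) {V : ℝ} {B : Set (A k ℓ)}
    (hB : IsOrthonormalBasis V B Set.univ) :
    IsOrthonormalBasis V (raiseLin h '' B) (raised k q ℓ d) := by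
  refine ⟨?_, ?_, ?_⟩
  · rintro _ ⟨φ, hφ, rfl⟩
    rw [inner_raiseLin, hB.1 φ hφ]
  · rintro _ ⟨φ, hφ, rfl⟩ _ ⟨ψ, hψ, rfl⟩ hne
    rw [inner_raiseLin, hB.2.1 φ hφ ψ hψ fun heq ↦ hne (by rw [heq])]
  · rw [← Submodule.map_span, Submodule.map_coe, hB.2.2, Set.image_univ]
    ext f
    simp only [Set.mem_range, raised, Set.mem_ofPred_eq, ← coe_raiseLin h, DFunLike.coe_fn_eq,
      eq_comm]

end RaiseIsometry

/-- Evaluation of cusp forms at a point of the upper half-plane. -/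
def evalLin {k ℓ : ℕ} (z : ℍ) : A k ℓ →ₗ[ℂ] ℂ where
  toFun f := f z
  map_add' _ _ := rfl
  map_smul' _ _ := rfl

section HilbertSpace

variable {k ℓ : ℕ} [NeZero ℓ] {V : ℝ}

/-- The norm on `A k ℓ` induced by the Petersson inner product. -/
abbrev peterssonNormedAddCommGroup (hV : 0 < V) (k ℓ : ℕ) [NeZero ℓ] : NormedAddCommGroup (A k ℓ) :=
  (innerCore hV k ℓ).toNormedAddCommGroup

/-- The Hilbert space structure on `A k ℓ` given by the Petersson inner product. It depends on the
normalisation `V`, so it is not an instance. -/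
abbrev peterssonInnerProductSpace (hV : 0 < V) (k ℓ : ℕ) [NeZero ℓ] :
    letI := peterssonNormedAddCommGroup hV k ℓ
    InnerProductSpace ℂ (A k ℓ) :=
  InnerProductSpace.ofCore (innerCore hV k ℓ).toCore

theorem isOrthogonalProjector_iff (hV : 0 < V) {E : A k ℓ →ₗ[ℂ] A k ℓ} {W : Submodule ℂ (A k ℓ)} :
    letI := peterssonNormedAddCommGroup hV k ℓ
    letI := peterssonInnerProductSpace hV k ℓ
    IsOrthogonalProjector V E (W : Set (A k ℓ)) ↔ ∀ f, E f = W.starProjection f := by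
  let := peterssonNormedAddCommGroup hV k ℓ
  let := peterssonInnerProductSpace hV k ℓ
  refine forall_congr' fun f ↦ ⟨fun h ↦ ?_, fun h ↦ ?_⟩
  · exact (W.eq_starProjection_of_mem_orthogonal h.1 h.2).symm
  · rw [h]
    exact ⟨W.starProjection_apply_mem f, W.sub_starProjection_mem_orthogonal f⟩

theorem exists_isOrthogonalProjector (hV : 0 < V) (W : Submodule ℂ (A k ℓ)) :
    ∃ E : A k ℓ →ₗ[ℂ] A k ℓ, IsOrthogonalProjector V E (W : Set (A k ℓ)) := by
  let := peterssonNormedAddCommGroup hV k ℓ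
  let := peterssonInnerProductSpace hV k ℓ
  exact ⟨W.starProjection, (isOrthogonalProjector_iff hV).2 fun _ ↦ rfl⟩

namespace IsOrthonormalBasis

variable {B W : Set (A k ℓ)}

theorem orthonormal (hV : 0 < V) (hB : IsOrthonormalBasis V B W) :
    letI := peterssonNormedAddCommGroup hV k ℓ
    letI := peterssonInnerProductSpace hV k ℓ
    Orthonormal ℂ ((↑) : B → A k ℓ) := by
  classical
  let := peterssonNormedAddCommGroup hV k ℓ
  let := peterssonInnerProductSpace hV k ℓ
  refine orthonormal_subtype_iff_ite.2 fun φ hφ ψ hψ ↦ ?_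
  split_ifs with h
  · rw [← h]
    exact hB.1 φ hφ
  · exact hB.2.1 φ hφ ψ hψ h

theorem finite (hV : 0 < V) (hB : IsOrthonormalBasis V B W) : B.Finite := by
  let := peterssonNormedAddCommGroup hV k ℓ
  let := peterssonInnerProductSpace hV k ℓ
  exact (hB.orthonormal hV).linearIndependent.setFinite

end IsOrthonormalBasis

-- `κ` is the reproducing form: the Riesz representative of evaluation at `z₂`.
theorem exists_forall_finsum_mul_conj_eq (hV : 0 < V) (z₂ : ℍ) :
    ∃ κ : A k ℓ, ∀ {E : A k ℓ →ₗ[ℂ] A k ℓ} {B W : Set (A k ℓ)}, IsOrthogonalProjector V E W →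
      IsOrthonormalBasis V B W → ∀ z₁, ∑ᶠ φ ∈ B, φ z₁ * conj (φ z₂) = E κ z₁ := by
  let := peterssonNormedAddCommGroup hV k ℓ
  let := peterssonInnerProductSpace hV k ℓ
  have : CompleteSpace (A k ℓ) := FiniteDimensional.complete ℂ _
  let evalCLM (z : ℍ) : StrongDual ℂ (A k ℓ) := (evalLin z).toContinuousLinearMap
  refine ⟨(InnerProductSpace.toDual ℂ (A k ℓ)).symm (evalCLM z₂), fun {E B W} hE hB z₁ ↦ ?_⟩
  have hEB := (isOrthogonalProjector_iff hV (W := Submodule.span ℂ B)).1 (hB.2.2 ▸ hE)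
  rw [hEB]
  exact finsum_mul_conj_eq_apply_starProjection (hB.finite hV) (hB.orthonormal hV)
    (evalCLM z₁) (evalCLM z₂)

end HilbertSpace

section Newspace

open ArithmeticFunction (moebius)

theorem mul_mul_dvd_of_squarefree {q : ℕ} (hq : q ≠ 0)
    (hcube : ∀ p : ℕ, p.Prime → p ∣ q → p ^ 3 ∣ q) {a b c : ℕ} (ha : Squarefree a)
    (hb : Squarefree b) (hc : Squarefree c) (haq : a ∣ q) (hbq : b ∣ q) (hcq : c ∣ q) :
    a * b * c ∣ q := by
  have hab : a * b ≠ 0 := mul_ne_zero ha.ne_zero hb.ne_zero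
  rw [← Nat.factorization_le_iff_dvd (mul_ne_zero hab hc.ne_zero) hq,
    Nat.factorization_mul hab hc.ne_zero, Nat.factorization_mul ha.ne_zero hb.ne_zero]
  intro p
  simp only [Finsupp.add_apply]
  by_cases hp : p.Prime
  · by_cases hpq : p ∣ q
    · have hthree := (hp.pow_dvd_iff_le_factorization hq).1 (hcube p hp hpq)
      linarith [ha.natFactorization_le_one p, hb.natFactorization_le_one p,
        hc.natFactorization_le_one p]
    · have hzero {n : ℕ} (hn : n ∣ q) : n.factorization p = 0 :=
        Nat.factorization_eq_zero_of_not_dvd fun h ↦ hpq (h.trans hn)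
      simp [hzero haq, hzero hbq, hzero hcq]
  · simp [Nat.factorization_eq_zero_of_not_prime _ hp]

theorem mul_dvd_of_squarefree {q : ℕ} (hq : q ≠ 0)
    (hcube : ∀ p : ℕ, p.Prime → p ∣ q → p ^ 3 ∣ q) {d e : ℕ} (hd : Squarefree d)
    (he : Squarefree e) (hdq : d ∣ q) (heq : e ∣ q) : d * e ∣ q := by
  simpa using mul_mul_dvd_of_squarefree hq hcube hd he squarefree_one hdq heq (one_dvd _)

variable {k q : ℕ} [NeZero q] {V : ℝ}

theorem isMulProjectionFamily_raisedSubmodule (hV : 0 < V)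
    (hcube : ∀ p : ℕ, p.Prime → p ∣ q → p ^ 3 ∣ q) :
    letI := peterssonNormedAddCommGroup hV k q
    letI := peterssonInnerProductSpace hV k q
    IsMulProjectionFamily q (raisedSubmodule k q) := by
  let := peterssonNormedAddCommGroup hV k q
  let := peterssonInnerProductSpace hV k q
  intro p d e hp hpq hdq heq hd he hpd
  have : NeZero p := ⟨hp.ne_zero⟩
  have : NeZero d := ⟨hd.ne_zero⟩
  have : NeZero e := ⟨he.ne_zero⟩
  obtain ⟨m, hm⟩ := mul_mul_dvd_of_squarefree (NeZero.ne q) hcube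
    (squarefree_mul_prime hd hp hpd) he hp.prime.squarefree (mul_prime_dvd hdq hp hpq hpd) heq hpq
  have : NeZero m := ⟨right_ne_zero_of_mul (hm ▸ NeZero.ne q)⟩
  have hlevel : q / (d * e) = p * (p * m) :=
    Nat.div_eq_of_eq_mul_right (NeZero.pos _) (by rw [hm]; ring)
  have hlevel' : q / (d * p * e) = p * m :=
    Nat.div_eq_of_eq_mul_right (NeZero.pos _) (by rw [hm]; ring)
  have hdvd : d * p * e ∣ q := ⟨p * m, by rw [hm]; ring⟩
  refine starProjection_comp_starProjection_eq
    (raisedSubmodule_le (dvd_mul_left p d) (one_dvd e) hdvd)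
    (raisedSubmodule_le (dvd_mul_right d p) dvd_rfl hdvd) fun f hf ↦ ?_
  obtain ⟨u, hu, hcoe⟩ := exists_upperAvg_mem_raised (ℓ := p * m) ⟨e, by rw [hm]; ring⟩
    (dvd_mul_right p m) (hp.coprime_iff_not_dvd.2 hpd).symm (hlevel ▸ hf : f ∈ raised k q _ d)
  exact ⟨u, (hlevel' ▸ hu : u ∈ raised k q (q / (d * p * e)) (d * p)),
    fun w hw ↦ inner_eq_of_coe_eq_upperAvg V dvd_rfl hw hcoe⟩

theorem isMulProjectionFamily_raisedSubmodule_swap (hV : 0 < V)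
    (hcube : ∀ p : ℕ, p.Prime → p ∣ q → p ^ 3 ∣ q) :
    letI := peterssonNormedAddCommGroup hV k q
    letI := peterssonInnerProductSpace hV k q
    IsMulProjectionFamily q fun e d ↦ raisedSubmodule k q d e := by
  let := peterssonNormedAddCommGroup hV k q
  let := peterssonInnerProductSpace hV k q
  intro p e d hp hpq heq hdq he hd hpe
  have : NeZero p := ⟨hp.ne_zero⟩
  have : NeZero d := ⟨hd.ne_zero⟩
  have : NeZero e := ⟨he.ne_zero⟩
  obtain ⟨m, hm⟩ := mul_mul_dvd_of_squarefree (NeZero.ne q) hcube hd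
    (squarefree_mul_prime he hp hpe) hp.prime.squarefree hdq (mul_prime_dvd heq hp hpq hpe) hpq
  have : NeZero m := ⟨right_ne_zero_of_mul (hm ▸ NeZero.ne q)⟩
  have hlevel : q / (d * e) = p * (p * m) :=
    Nat.div_eq_of_eq_mul_right (NeZero.pos _) (by rw [hm]; ring)
  have hlevel' : q / (d * (e * p)) = p * m :=
    Nat.div_eq_of_eq_mul_right (NeZero.pos _) (by rw [hm]; ring)
  have hprime : 1 * (q / (1 * p)) ∣ d * (e * (p * m)) := by
    rw [one_mul, one_mul, Nat.div_eq_of_eq_mul_right (k := d * (e * (p * m))) hp.pos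
      (by rw [hm]; ring)]
  have hdvd : d * (e * p) ∣ q := ⟨p * m, by rw [hm]; ring⟩
  refine starProjection_comp_starProjection_eq
    (raisedSubmodule_le (one_dvd d) (dvd_mul_left p e) hdvd)
    (raisedSubmodule_le dvd_rfl (dvd_mul_right e p) hdvd) fun f hf ↦ ?_
  obtain ⟨u, hu, hcoe⟩ := exists_lowerAvg_mem_raised (ℓ := p * m) ⟨e * p, by rw [hm]; ring⟩
    (dvd_mul_right p m) (hp.coprime_iff_not_dvd.2 hpe).symm (hlevel ▸ hf : f ∈ raised k q _ d)
  exact ⟨u, (hlevel' ▸ hu : u ∈ raised k q (q / (d * (e * p))) d),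
    fun w hw ↦ inner_eq_of_coe_eq_lowerAvg V hprime hw hcoe⟩

theorem isOrthogonalProjector_newspace (hV : 0 < V)
    (hcube : ∀ p : ℕ, p.Prime → p ∣ q → p ^ 3 ∣ q) {E : ℕ → ℕ → (A k q →ₗ[ℂ] A k q)}
    (hE : ∀ d e : ℕ, d ∣ q → e ∣ q → Squarefree d → Squarefree e →
      IsOrthogonalProjector V (E d e) (raised k q (q / (d * e)) d)) :
    IsOrthogonalProjector V (∑ d ∈ q.divisors, ∑ e ∈ q.divisors,
      ((moebius d * moebius e : ℤ) : ℂ) • E d e) (newspace V k q) := by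
  let := peterssonNormedAddCommGroup hV k q
  let := peterssonInnerProductSpace hV k q
  have : CompleteSpace (A k q) := FiniteDimensional.complete ℂ _
  have hnew : newspace V k q = ((oldspace k q)ᗮ : Set (A k q)) := rfl
  rw [hnew, isOrthogonalProjector_iff hV]
  intro f
  simp only [oldspace_eq_iSup, LinearMap.sum_apply, LinearMap.smul_apply, Int.cast_smul_eq_zsmul]
  rw [← sum_moebius_starProjection_eq (W := raisedSubmodule k q) (NeZero.ne q)
    raisedSubmodule_one_one (isMulProjectionFamily_raisedSubmodule hV hcube)
    (isMulProjectionFamily_raisedSubmodule_swap hV hcube)]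
  refine Finset.sum_congr rfl fun d hd ↦ Finset.sum_congr rfl fun e he ↦ ?_
  by_cases hs : Squarefree d ∧ Squarefree e
  · have hEde : IsOrthogonalProjector V (E d e) (raisedSubmodule k q d e : Set (A k q)) :=
      hE d e (Nat.dvd_of_mem_divisors hd) (Nat.dvd_of_mem_divisors he) hs.1 hs.2
    rw [(isOrthogonalProjector_iff hV).1 hEde f]
  · rw [not_and_or] at hs
    rcases hs with hs | hs <;> simp [ArithmeticFunction.moebius_eq_zero_of_not_squarefree hs]

theorem finsum_newspace_mul_conj_eq (hV : 0 < V)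
    (hcube : ∀ p : ℕ, p.Prime → p ∣ q → p ^ 3 ∣ q) {Bnew : Set (A k q)}
    {B : (ℓ : ℕ) → Set (A k ℓ)} (hnew : IsOrthonormalBasis V Bnew (newspace V k q))
    (hB : ∀ ℓ : ℕ, ℓ ∣ q → IsOrthonormalBasis V (B ℓ) Set.univ) (z₁ z₂ : ℍ) :
    ∑ᶠ φ ∈ Bnew, φ z₁ * conj (φ z₂) = ∑ d ∈ q.divisors, ∑ e ∈ q.divisors,
      ((moebius d * moebius e : ℤ) : ℂ) *
        ∑ᶠ φ ∈ B (q / (d * e)), raise d φ z₁ * conj (raise d φ z₂) := by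
  choose E hE using fun d e ↦ exists_isOrthogonalProjector hV (raisedSubmodule k q d e)
  obtain ⟨κ, hκ⟩ := exists_forall_finsum_mul_conj_eq hV (k := k) (ℓ := q) z₂
  have heval (f : A k q) : f z₁ = evalLin z₁ f := rfl
  rw [hκ (isOrthogonalProjector_newspace hV hcube fun d e _ _ _ _ ↦ hE d e) hnew, heval]
  simp only [LinearMap.sum_apply, LinearMap.smul_apply, map_sum, map_smul, smul_eq_mul]
  refine Finset.sum_congr rfl fun d hd ↦ Finset.sum_congr rfl fun e he ↦ ?_
  by_cases hs : Squarefree d ∧ Squarefree e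
  · have hde : d * e ∣ q := mul_dvd_of_squarefree (NeZero.ne q) hcube hs.1 hs.2
      (Nat.dvd_of_mem_divisors hd) (Nat.dvd_of_mem_divisors he)
    have : NeZero d := ⟨hs.1.ne_zero⟩
    have : NeZero (q / (d * e)) := ⟨(Nat.div_ne_zero_iff_of_dvd hde).2
      ⟨NeZero.ne q, mul_ne_zero hs.1.ne_zero hs.2.ne_zero⟩⟩
    have hlevel : d * (q / (d * e)) ∣ q :=
      (mul_dvd_mul_right (dvd_mul_right d e) _).trans (Nat.mul_div_cancel' hde).dvd
    rw [← heval, ← hκ (hE d e) ((hB _ (Nat.div_dvd_of_dvd hde)).image_raiseLin hlevel),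
      finsum_mem_image (raiseLin_injective hlevel).injOn]
    simp only [coe_raiseLin]
  · rw [not_and_or] at hs
    rcases hs with hs | hs <;> simp [ArithmeticFunction.moebius_eq_zero_of_not_squarefree hs]

end Newspace

end NewformKernel

end

theorem theorem1 (k : ℕ) (hk : 0 < k) (q : ℕ) (hq : 0 < q)
    (hcube : ∀ p : ℕ, p.Prime → p ∣ q → p ^ 3 ∣ q) (V : ℝ) (hV : 0 < V) :
    (∀ (Bnew : Set (NewformKernel.A k q)) (B : (ℓ : ℕ) → Set (NewformKernel.A k ℓ)),
      NewformKernel.IsOrthonormalBasis V Bnew (NewformKernel.newspace V k q) →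
      (∀ ℓ : ℕ, ℓ ∣ q → NewformKernel.IsOrthonormalBasis V (B ℓ) Set.univ) →
      Bnew.Finite ∧ (∀ ℓ : ℕ, ℓ ∣ q → (B ℓ).Finite) ∧
      ∀ z₁ z₂ : ℍ,
        ∑ᶠ φ ∈ Bnew, φ z₁ * conj (φ z₂) =
          ∑ d ∈ q.divisors, ∑ e ∈ q.divisors,
            ((ArithmeticFunction.moebius d * ArithmeticFunction.moebius e : ℤ) : ℂ) *
              ∑ᶠ φ ∈ B (q / (d * e)),
                NewformKernel.raise d φ z₁ * conj (NewformKernel.raise d φ z₂)) ∧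
    (∀ d e : ℕ, d ∣ q → e ∣ q → Squarefree d → Squarefree e →
      ∃ E : NewformKernel.A k q →ₗ[ℂ] NewformKernel.A k q,
        NewformKernel.IsOrthogonalProjector V E (NewformKernel.raised k q (q / (d * e)) d)) ∧
    (∀ E : ℕ → ℕ → (NewformKernel.A k q →ₗ[ℂ] NewformKernel.A k q),
      (∀ d e : ℕ, d ∣ q → e ∣ q → Squarefree d → Squarefree e →
        NewformKernel.IsOrthogonalProjector V (E d e)
          (NewformKernel.raised k q (q / (d * e)) d)) →
      NewformKernel.IsOrthogonalProjector V
        (∑ d ∈ q.divisors, ∑ e ∈ q.divisors,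
          ((ArithmeticFunction.moebius d * ArithmeticFunction.moebius e : ℤ) : ℂ) • E d e)
        (NewformKernel.newspace V k q)) := by
  have : NeZero q := ⟨hq.ne'⟩
  refine ⟨fun Bnew B hnew hB ↦ ⟨hnew.finite hV, fun ℓ hℓ ↦ ?_,
      NewformKernel.finsum_newspace_mul_conj_eq hV hcube hnew hB⟩,
    fun d e _ _ _ _ ↦ NewformKernel.exists_isOrthogonalProjector hV
      (NewformKernel.raisedSubmodule k q d e),
    fun _ hE ↦ NewformKernel.isOrthogonalProjector_newspace hV hcube hE⟩
  have : NeZero ℓ := ⟨(Nat.pos_of_dvd_of_pos hℓ hq).ne'⟩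
  exact (hB ℓ hℓ).finite hV
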